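/- \textbf{Setting.} A (labelled) MDP $\mathcal M=(S,s_0,A,P,L)$ has a finite set $S$ of states, an initial state $s_0$, a finite set $A$ of actions, transition probabilities with $\sum_{s'}P(s,a,s')\in\{0,1\}$ for all $s,a$, and labels $L(s)\subseteq AP$. $A(s)$ is the set of actions with sum $1$ (the enabled ones). A (memoryless, randomised) scheduler $\mu\in Sch(\mathcal M)$ assigns to each state $s$ a distribution over $A(s)$ (in a state with $A(s)=\emptyset$ no action is taken and the process stays there); together with $\mathcal M$ it induces a probability measure on infinite paths $s_1a_1s_2a_2\ldots$ from the initial state. For a real-valued reward structure $\rho$ on the pairs $(s,a)$, $a\in A(s)$, and a Boolean formula $B$ over $AP$, the reachability reward $\mathbf E^{\mathcal M[\rho],\mu}(\Diamond B)$ is the expectation of $\sum_{k<m}\rho(s_k,a_k)$, where $m$ is the first index with $L(s_m)\models B$; the sum is replaced by $+\infty$ on paths without such $m$. $\mathcal M[\rho]$ is reward-finite w.r.t. $\Diamond B$ if $\sup_\mu\mathbf E^{\mathcal M[\rho],\mu}(\Diamond B)<\infty$. Let $n\ge 1$ and $I=J=\{1,\dots,n\}$. For each $i\in I$ let agent $i$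 be an MDP $\mathcal M_i=(S_i,s_{i,0},A_i,P_i,L_i)$ with a reward structure $\rho_i$; for each $j\in J$ let task $j$ be a DFA $\mathcal A_j=(Q_j,q_{j,0},Q_{j,F},2^{AP},\delta_j)$ with finite $Q_j$ whose accepting locations are sinks. A location is a successor of $q$ if it equals $\delta_j(q,W)$ for some $W\subseteq AP$; a trap is a location from which no accepting location can be reached, and $Q_{j,R}$ is the set of traps of $\mathcal A_j$. Task $j$ is \emph{ended} at $q$ if $q\in Q_{j,F}\cup Q_{j,R}$. The agent-task MDP $\mathcal M_{i\otimes j}$ has states $S_i\times Q_j$, initial state $(s_{i,0},q_{j,0})$, actions $A_i$, transition probabilities $P_{i,j}(s,q,a,s',q')=P_i(s,a,s')$ if $q'=\delta_j(q,L_i(s'))$ and $0$ otherwise, the labels of $\mathcal M_i$, and a proposition $\mathtt{done}_j$ true at $(s,q)$ iff task $j$ is ended at $q$. It carries the reward structure $\rho_i(s,q,a)=\rho_i(s,a)$ and the reward structure $\rho_{n+j}(s,q,a)=1$ if $q\notin Q_{j,F}$ and all successors of $q$ are in $Q_{j,F}$, and $0$ otherwise. Write $\mathbf E^{\mathcal M_{i\otimes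 j}[\rho],\mu}$ for $\mathbf E^{\mathcal M_{i\otimes j}[\rho],\mu}(\Diamond\mathtt{done}_j)$. Assume that every $\mathcal M_{i\otimes j}[\rho_i]$ is reward-finite w.r.t. $\Diamond\mathtt{done}_j$. Given $p\in[0,1]^J$ and $c\in\mathbb R^I$, the MORAP problem is \emph{feasible} if there are a bistochastic matrix $(x_{i,j})$ and schedulers $\mu_{i,j}\in Sch(\mathcal M_{i\otimes j})$ such that $$\sum_{i}x_{i,j}\,\mathbf E^{\mathcal M_{i\otimes j}[\rho_{n+j}],\mu_{i,j}}\ge p_j\ \ (j\in J),\qquad \sum_{j}x_{i,j}\,\mathbf E^{\mathcal M_{i\otimes j}[\rho_i],\mu_{i,j}}\ge c_i\ \ (i\in I).$$ The \emph{centralised MDP} $\mathcal M^{\mathsf{ct}}$ has the state space $\biguplus_{i,j}S_i\times Q_j\times 2^I$, the initial state $(s_{1,0},q_{1,0},\emptyset)$, the actions $\bigcup_iA_i\uplus\{b_1,b_2,b_3\}$, and, at a state $(s,q,\sharp)$ with $s\in S_i$, $q\in Q_j$, the following transitions and no others: \begin{itemize} \item if $i\in\sharp$, and $j=n$ or task $j$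 is not ended at $q$: every $a\in A_i(s)$ is enabled and leads to $(s',q',\sharp)$, $s'\in S_i$, $q'\in Q_j$, with probability $P_{i,j}(s,q,a,s',q')$; \item if $(s,q)=(s_{i,0},q_{j,0})$ and $i\notin\sharp$: $b_1$ leads to $(s,q,\sharp\cup\{i\})$ in the same copy $S_i\times Q_j\times 2^I$; \item if $(s,q)=(s_{i,0},q_{j,0})$, $i\notin\sharp$ and $i'=\min\{k>i: k\notin\sharp\}$ exists: $b_2$ leads to $(s_{i',0},q,\sharp)$; \item if $i\in\sharp$, $j<n$, task $j$ is ended at $q$, and $i'=\min\{k: k\notin\sharp\}$ exists: $b_3$ leads to $(s_{i',0},q_{j+1,0},\sharp)$. \end{itemize} Its proposition $\mathtt{done}$ holds at $(s,q,\sharp)$ with $q\in Q_j$ iff $j=n$ and task $n$ is ended at $q$. On $\mathcal M^{\mathsf{ct}}$, $\rho_i$ gives $\rho_i(s,a)$ to the actions $a\in A_i(s)$ at states with $s\in S_i$, $\rho_{n+j}$ gives $\rho_{n+j}(s,q,a)$ to the actions of agents at states with $q\in Q_j$, and both are $0$ otherwise (in particular on $b_1,b_2,b_3$). Write $\mathbf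 E^{\mathcal M^{\mathsf{ct}}[\rho],\mu}$ for $\mathbf E^{\mathcal M^{\mathsf{ct}}[\rho],\mu}(\Diamond\mathtt{done})$. \textbf{Theorem.} The MORAP problem is feasible with respect to $(p_j)_{j\in J}$ and $(c_i)_{i\in I}$ if and only if there is $\mu\in Sch(\mathcal M^{\mathsf{ct}})$ such that $\mathbf E^{\mathcal M^{\mathsf{ct}}[\rho_{n+j}],\mu}\ge p_j$ and $\mathbf E^{\mathcal M^{\mathsf{ct}}[\rho_i],\mu}\ge c_i$ for all $i\in I$, $j\in J$. -/

import Mathlib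

open scoped NNReal ENNReal

noncomputable section

/-! ### Markov decision processes -/

/-- A labelled Markov decision process with finite state space `S`, actions `Act` and atomic
propositions `AP`.  For every state and action the outgoing probabilities sum to `0` (the action is
disabled) or to `1` (the action is enabled). -/
structure MDP (S Act AP : Type*) [Fintype S] where
  /-- initial state -/
  init : S
  /-- transition probabilities -/
  P : S → Act → S → ℝ≥0
  sum_P : ∀ s a, ∑ s', P s a s' = 0 ∨ ∑ s', P s a s' = 1
  /-- labelling -/
  L : S → Set AP

/-- One step of a path: a state together with the action taken there (`none` stands for "no action
is taken", which happens exactly in states where no action is enabled). -/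
structure PathStep (S Act : Type*) where
  state : S
  act : Option Act

instance {S Act : Type*} : MeasurableSpace (PathStep S Act) := ⊤

instance {S Act : Type*} : DiscreteMeasurableSpace (PathStep S Act) := ⟨fun _ => trivial⟩

namespace MDP

variable {S Act AP : Type*} [Fintype S]

/-- The set `A(s)` of actions enabled at `s`. -/
def enabled (M : MDP S Act AP) (s : S) : Set Act :=
  {a | ∑ s', M.P s a s' = 1}

/-- A memoryless randomised scheduler: in every state `s` a probability distribution over the
enabled actions `A(s)`.  In a state without enabled actions no action is taken. -/
structure Scheduler (M : MDP S Act AP) where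
  choice : S → PMF (Option Act)
  enabled_of_mem : ∀ s a, some a ∈ (choice s).support → a ∈ M.enabled s
  blocked_of_mem : ∀ s, none ∈ (choice s).support → M.enabled s = ∅

open Classical in
/-- Distribution of the successor state after taking an action.  When no action is taken the
process stays where it is. -/
def next (M : MDP S Act AP) (s : S) : Option Act → PMF S
  | some a =>
    if h : ∑ s', M.P s a s' = 1 then
      PMF.ofFintype (fun s' => (M.P s a s' : ℝ≥0∞)) (by exact_mod_cast h)
    else PMF.pure s
  | none => PMF.pure s

namespace Scheduler

variable {M : MDP S Act AP}

/-- The distribution of the path step taken at state `s`. -/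
def stepAt (μ : M.Scheduler) (s : S) : PMF (PathStep S Act) :=
  (μ.choice s).map (fun a => ⟨s, a⟩)

/-- The Markov kernel of the induced Markov chain on path steps. -/
def kernel (μ : M.Scheduler) : ProbabilityTheory.Kernel (PathStep S Act) (PathStep S Act) where
  toFun x := ((M.next x.state x.act).bind μ.stepAt).toMeasure
  measurable' := Measurable.of_discrete

instance (μ : M.Scheduler) : ProbabilityTheory.IsMarkovKernel μ.kernel :=
  ⟨fun x => by
    change MeasureTheory.IsProbabilityMeasure
      ((M.next x.state x.act).bind μ.stepAt).toMeasure
    infer_instance⟩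

/-- The probability measure on the infinite paths of `M` that start in the initial state, induced by
the scheduler `μ`. -/
def pathMeasure (μ : M.Scheduler) : MeasureTheory.Measure (ℕ → PathStep S Act) :=
  ProbabilityTheory.Kernel.trajMeasure (X := fun _ => PathStep S Act)
    (μ.stepAt M.init).toMeasure
    (fun k => μ.kernel.comap (fun h => h ⟨k, Finset.mem_Iic.2 le_rfl⟩) (measurable_pi_apply _))

end Scheduler

/-- The reward collected in one path step. -/
def stepReward (ρ : S → Act → ℝ) (x : PathStep S Act) : ℝ :=
  match x.act with
  | some a => ρ x.state a
  | none => 0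

open Classical in
/-- The reward accumulated along the path `π` before the first state whose label satisfies the
Boolean formula `B` is reached; it is `∞` when no such state is reached. -/
def pathReward (M : MDP S Act AP) (ρ : S → Act → ℝ) (B : Set AP → Prop)
    (π : ℕ → PathStep S Act) : EReal :=
  if h : ∃ k, B (M.L (π k).state) then
    ((∑ k ∈ Finset.range (Nat.find h), stepReward ρ (π k) : ℝ) : EReal)
  else ⊤

/-- The reachability reward: the integral of the accumulated reward over all paths, as the integral
of the positive part minus the integral of the negative part.  (For a finite MDP the second integral
is always finite, since the hitting time of `B` has a geometric tail on the event that `B` is hit,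
so that the difference is never `∞ - ∞`.) -/
def reachReward (M : MDP S Act AP) (ρ : S → Act → ℝ) (B : Set AP → Prop) (μ : M.Scheduler) :
    EReal :=
  ((∫⁻ π, (M.pathReward ρ B π).toENNReal ∂μ.pathMeasure : ℝ≥0∞) : EReal) -
    ((∫⁻ π, (-M.pathReward ρ B π).toENNReal ∂μ.pathMeasure : ℝ≥0∞) : EReal)

/-- `M[ρ]` is reward-finite with respect to reaching `B`. -/
def RewardFinite (M : MDP S Act AP) (ρ : S → Act → ℝ) (B : Set AP → Prop) : Prop :=
  (⨆ μ : M.Scheduler, M.reachReward ρ B μ) < ⊤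

open Classical in
/-- The product of an MDP with a DFA reading the labels of the states entered. -/
def product (M : MDP S Act AP) {Q : Type*} [Fintype Q] (T : DFA (Set AP) Q) :
    MDP (S × Q) Act AP where
  init := (M.init, T.start)
  P x a y := if y.2 = T.step x.2 (M.L y.1) then M.P x.1 a y.1 else 0
  sum_P x a := by
    have : ∑ y : S × Q, (if y.2 = T.step x.2 (M.L y.1) then M.P x.1 a y.1 else 0)
        = ∑ s', M.P x.1 a s' := by
      rw [Fintype.sum_prod_type]
      simp
    rw [this]
    exact M.sum_P x.1 a
  L x := M.L x.1

end MDP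

/-! ### Tasks -/

namespace DFA

variable {α Q : Type*}

/-- The set of successors of a location. -/
def suc (T : DFA α Q) (q : Q) : Set Q := {q' | ∃ W, T.step q W = q'}

/-- A trap is a location from which there is no run to an accepting location. -/
def IsTrap (T : DFA α Q) (q : Q) : Prop :=
  ∀ q' ∈ T.accept, ¬ Relation.ReflTransGen (fun q₁ q₂ => q₂ ∈ T.suc q₁) q q'

/-- The task is ended (accomplished or failed) at `q`. -/
def Ended (T : DFA α Q) (q : Q) : Prop := q ∈ T.accept ∨ T.IsTrap q

/-- Non-accepting locations all of whose successors are accepting. -/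
def PreAccept (T : DFA α Q) (q : Q) : Prop := q ∉ T.accept ∧ T.suc q ⊆ T.accept

end DFA

/-! ### Agent-task MDPs and random assignment and planning -/

/-- The agent-task MDP: the product of agent `M` and task `T`, with an additional atomic proposition
`none` (read: "done") that holds exactly at the states where the task is ended. -/
def agentTask {S Q Act AP : Type*} [Fintype S] [Fintype Q] (M : MDP S Act AP)
    (T : DFA (Set AP) Q) : MDP (S × Q) Act (Option AP) where
  init := (M.product T).init
  P := (M.product T).P
  sum_P := (M.product T).sum_P
  L x := {w | (∃ p ∈ (M.product T).L x, w = some p) ∨ (w = none ∧ T.Ended x.2)}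

/-- The Boolean formula "done" for agent-task MDPs. -/
def TaskDone {AP : Type*} (W : Set (Option AP)) : Prop := none ∈ W

/-- An agent's reward structure on the agent-task MDP. -/
def costReward {S Q Act : Type*} (ρ : S → Act → ℝ) (x : S × Q) (a : Act) : ℝ := ρ x.1 a

open Classical in
/-- The designated reward structure of a task: a unit reward at the pre-accepting locations. -/
def taskReward {S Q Act α : Type*} (T : DFA α Q) (x : S × Q) (_a : Act) : ℝ :=
  if T.PreAccept x.2 then 1 else 0

section Morap

variable {n : ℕ} {S Q : Fin n → Type*} {Act AP : Type*}
  [∀ i, Fintype (S i)] [∀ j, Fintype (Q j)]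

/-- Feasibility of the multi-objective random assignment and planning problem with agents `M i`
(with reward structures `ρ i`), tasks `T j`, probability thresholds `p j` and cost thresholds
`c i`. -/
def MorapFeasible (M : ∀ i, MDP (S i) Act AP) (T : ∀ j, DFA (Set AP) (Q j))
    (ρ : ∀ i, S i → Act → ℝ) (p c : Fin n → ℝ) : Prop :=
  ∃ x ∈ doublyStochastic ℝ (Fin n), ∃ μ : ∀ i j, (agentTask (M i) (T j)).Scheduler,
    (∀ j, (p j : EReal) ≤ ∑ i, (x i j : EReal) *
      (agentTask (M i) (T j)).reachReward (taskReward (T j)) TaskDone (μ i j)) ∧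
    (∀ i, (c i : EReal) ≤ ∑ j, (x i j : EReal) *
      (agentTask (M i) (T j)).reachReward (costReward (ρ i)) TaskDone (μ i j))

/-! ### The centralised MDP -/

/-- The states of the centralised MDP: the disjoint union over all agents `i` and tasks `j` of
`S i × Q j × 2^I`.  The state `⟨(i, j), s, q, U⟩` says that task `j` is considered with agent `i`, in
product state `(s, q)`, while `U` is the set of agents that have already been assigned a task. -/
abbrev CtState (S Q : Fin n → Type*) : Type _ :=
  Σ ij : Fin n × Fin n, S ij.1 × Q ij.2 × Finset (Fin n)

/-- The additional actions `b₁` (assign the task to the current agent), `b₂` (forward the task to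
the next agent) and `b₃` (consider the next task). -/
inductive Ctrl
  | assign
  | forward
  | nextTask

open Classical in
/-- The (deterministic) effect of an additional action; `none` if it is disabled. -/
def ctrlNext (M : ∀ i, MDP (S i) Act AP) (T : ∀ j, DFA (Set AP) (Q j)) :
    Ctrl → CtState S Q → Option (CtState S Q)
  | .assign, ⟨(i, j), s, q, U⟩ =>
    if s = (M i).init ∧ q = (T j).start ∧ i ∉ U then some ⟨(i, j), s, q, insert i U⟩ else none
  | .forward, ⟨(i, j), s, q, U⟩ =>
    if s = (M i).init ∧ q = (T j).start ∧ i ∉ U then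
      if h : (Finset.univ.filter fun k : Fin n => i < k ∧ k ∉ U).Nonempty then
        some ⟨(Finset.min' _ h, j), (M _).init, q, U⟩
      else none
    else none
  | .nextTask, ⟨(i, j), _, q, U⟩ =>
    if (T j).Ended q ∧ i ∈ U then
      if h : (Finset.univ.filter fun k : Fin n => k ∉ U).Nonempty ∧ (j : ℕ) + 1 < n then
        some ⟨(Finset.min' _ h.1, ⟨j + 1, h.2⟩), (M _).init, (T _).start, U⟩
      else none
    else none

open Classical in
/-- The transition probabilities of the centralised MDP.  An agent's action behaves as in the
agent-task MDP; it is available when the current agent has been assigned the current task and the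
model does not have to move on to the next task. -/
def ctP (M : ∀ i, MDP (S i) Act AP) (T : ∀ j, DFA (Set AP) (Q j))
    (x : CtState S Q) (act : Act ⊕ Ctrl) (y : CtState S Q) : ℝ≥0 :=
  match act with
  | .inl a =>
    match x with
    | ⟨(i, j), s, q, U⟩ =>
      if i ∈ U ∧ ¬ ((T j).Ended q ∧ (j : ℕ) + 1 < n) then
        ∑ z : S i × Q j,
          if y = ⟨(i, j), z.1, z.2, U⟩ then (agentTask (M i) (T j)).P (s, q) a z else 0
      else 0
  | .inr b => if ctrlNext M T b x = some y then 1 else 0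

/-- The centralised MDP.  Its only atomic proposition "done" holds exactly at the states where the
last task is ended. -/
def ctMDP [NeZero n] (M : ∀ i, MDP (S i) Act AP) (T : ∀ j, DFA (Set AP) (Q j)) :
    MDP (CtState S Q) (Act ⊕ Ctrl) Unit where
  init := ⟨(0, 0), (M 0).init, (T 0).start, ∅⟩
  P := ctP M T
  sum_P x act := by
    classical
    rcases act with a | b
    · obtain ⟨⟨i, j⟩, s, q, U⟩ := x
      simp only [ctP]
      split_ifs with h
      · rw [Finset.sum_comm]
        simpa using (agentTask (M i) (T j)).sum_P (s, q) a
      · simp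
    · simp only [ctP]
      cases ctrlNext M T b x with
      | none => simp
      | some z => simp
  L x := {_w | (x.1.2 : ℕ) + 1 = n ∧ (T x.1.2).Ended x.2.2.1}

/-- The Boolean formula "done" for the centralised MDP. -/
def CtDone (W : Set Unit) : Prop := () ∈ W

/-- A family of reward structures for the agent-task MDPs, viewed as a reward structure for the
centralised MDP: the additional actions carry no reward. -/
def ctReward (r : ∀ i j, S i × Q j → Act → ℝ) (x : CtState S Q) : Act ⊕ Ctrl → ℝ
  | .inl a => r x.1.1 x.1.2 (x.2.1, x.2.2.1) a
  | .inr _ => 0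

/-- The reward structure of agent `k` on the centralised MDP: zero while other agents act. -/
def ctCostReward (ρ : ∀ i, S i → Act → ℝ) (k : Fin n) : CtState S Q → Act ⊕ Ctrl → ℝ :=
  ctReward fun i _ z a => if i = k then costReward (ρ i) z a else 0

/-- The reward structure of task `k` on the centralised MDP: zero while other tasks are executed. -/
def ctTaskReward (T : ∀ j, DFA (Set AP) (Q j)) (k : Fin n) : CtState S Q → Act ⊕ Ctrl → ℝ :=
  ctReward fun _ j z a => if j = k then taskReward (T j) z a else 0

end Morap

end

/-!
A memoryless scheduler turns an MDP into a finite Markov chain on its states.  Kill this chain when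
the target `B` is entered.  If the expected hitting time is finite, the reachability reward is the
scalar product of the occupation vector (the expected numbers of visits before `B`) with the mean
one-step rewards; otherwise the chain reaches, with positive probability, a state from which `B` is
unreachable, and the reward is `+∞` because paths that miss `B` count as `+∞`
(`reachReward_eq_of_finiteHitting`, `reachReward_eq_top_of_not_finiteHitting`).  Hence
reward-finiteness forces *every* scheduler of an agent-task MDP to have finite expected hitting
time, and all rewards below are real numbers given by occupation vectors (`value`).

* Mixtures.  A convex combination of occupation vectors satisfies the balance equation of the
  scheduler that averages the actions with the occupations as weights; as all hitting times are
  finite, it is the occupation vector of that scheduler.  So one memoryless scheduler realises any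
  convex combination of rewards, for all reward structures at once (`exists_value_eq_sum`).

* The centralised MDP.  In a visited state the current task `j` waits to be assigned, is run by the
  assigned agent `i`, or is ended; while it is run, a scheduler induces a scheduler of the
  agent-task MDP.  A Lyapunov function shows that every scheduler ends the last task in finite
  expected time (`ct_finiteHitting`), and a verification argument with the potentials of the
  induced schedulers shows that the reward is the sum over `i`, `j` and the set `U` of assigned
  agents of the probability `assignMass` of this assignment times the reward of the induced scheduler
  (`ct_value_eq`).

* From the centralised MDP to an assignment.  Summed over `U`, the assignment probabilities form a
  doubly stochastic matrix: each task is assigned once and no agent is assigned twice.  The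
  exception is a last task that is ended from the start, which the centralised MDP need not assign
  before it is done; its column carries no reward and can be filled in so as to make the matrix
  doubly stochastic (`exists_doublyStochastic_assignment`).  Mixing the induced schedulers over `U`
  gives the schedulers of the assignment.

* From an assignment to the centralised MDP.  By the Birkhoff theorem the assignment is a mixture of
  permutations, the centralised MDP can follow each permutation (`permScheduler`), and the mixture
  is again realised by one memoryless scheduler (`exists_ctScheduler_of_assignment`).
-/

noncomputable section

/-! ### Substochastic matrices and occupation vectors -/

open Matrix Finset

/-- A substochastic matrix: the transition matrix of a finite Markov chain with killing. -/
structure IsSubstochastic {S : Type*} [Fintype S] (D : Matrix S S ℝ) : Prop where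
  nonneg : ∀ s t, 0 ≤ D s t
  row_le : ∀ s, ∑ t, D s t ≤ 1

section KilledChain

open scoped Classical

variable {S : Type*} [Fintype S] {D : Matrix S S ℝ} {v : S → ℝ}

/-- The distribution (of mass at most one) after `k` steps of the killed chain with initial
distribution `v` and transition matrix `D`. -/
def killedLaw (v : S → ℝ) (D : Matrix S S ℝ) (k : ℕ) : S → ℝ := v ᵥ* D ^ k

/-- The expected number of visits of each state. -/
def occupation (v : S → ℝ) (D : Matrix S S ℝ) (s : S) : ℝ := ∑' k, killedLaw v D k s

/-- The killed chain has finite expected lifetime. -/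
def FiniteLifetime (v : S → ℝ) (D : Matrix S S ℝ) : Prop :=
  Summable fun k => ∑ s, killedLaw v D k s

/-- The expected total reward `f` collected from each starting state until killing. -/
def potential (D : Matrix S S ℝ) (f : S → ℝ) (s : S) : ℝ := ∑' k, (D ^ k *ᵥ f) s

lemma killedLaw_zero : killedLaw v D 0 = v := by simp [killedLaw]

lemma killedLaw_succ (k : ℕ) : killedLaw v D (k + 1) = killedLaw v D k ᵥ* D := by
  simp [killedLaw, pow_succ, vecMul_vecMul]

lemma killedLaw_add (k l : ℕ) : killedLaw v D (k + l) = killedLaw v D k ᵥ* D ^ l := by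
  simp [killedLaw, pow_add, vecMul_vecMul]

lemma killedLaw_succ_apply (k : ℕ) (t : S) :
    killedLaw v D (k + 1) t = ∑ s, killedLaw v D k s * D s t := by
  rw [killedLaw_succ]; rfl

lemma killedLaw_nonneg (hD : IsSubstochastic D) (hv : ∀ s, 0 ≤ v s) (k : ℕ) (s : S) :
    0 ≤ killedLaw v D k s := by
  induction k generalizing s with
  | zero => simpa [killedLaw_zero] using hv s
  | succ k ih =>
    rw [killedLaw_succ_apply]
    exact sum_nonneg fun t _ => mul_nonneg (ih t) (hD.nonneg t s)

lemma pow_nonneg_of_substochastic (hD : IsSubstochastic D) (k : ℕ) (s t : S) :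
    0 ≤ (D ^ k) s t := by
  induction k generalizing s t with
  | zero => rw [pow_zero, Matrix.one_apply]; split_ifs <;> simp
  | succ k ih =>
    rw [pow_succ, Matrix.mul_apply]
    exact sum_nonneg fun u _ => mul_nonneg (ih s u) (hD.nonneg u t)

/-- The mass at time `k + l` in terms of the distribution at time `k` and the survival
probabilities `D ^ l *ᵥ 1`. -/
lemma sum_killedLaw_add (k l : ℕ) :
    ∑ s, killedLaw v D (k + l) s = ∑ s, killedLaw v D k s * (D ^ l *ᵥ 1) s := by
  have := dotProduct_mulVec (killedLaw v D k) (D ^ l) 1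
  rw [← killedLaw_add] at this
  simpa [dotProduct] using this.symm

lemma survival_nonneg (hD : IsSubstochastic D) (k : ℕ) (s : S) : 0 ≤ (D ^ k *ᵥ 1) s := by
  simp only [mulVec, dotProduct]
  exact sum_nonneg fun t _ => mul_nonneg (pow_nonneg_of_substochastic hD k s t) (by simp)

lemma survival_succ (k : ℕ) (s : S) :
    (D ^ (k + 1) *ᵥ 1) s = ∑ t, D s t * (D ^ k *ᵥ 1) t := by
  rw [pow_succ', ← mulVec_mulVec]; rfl

lemma survival_le_one (hD : IsSubstochastic D) (k : ℕ) (s : S) : (D ^ k *ᵥ 1) s ≤ 1 := by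
  induction k generalizing s with
  | zero => simp
  | succ k ih =>
    rw [survival_succ]
    refine le_trans (sum_le_sum fun t _ => ?_) (hD.row_le s)
    exact mul_le_of_le_one_right (hD.nonneg s t) (ih t)

lemma survival_antitone (hD : IsSubstochastic D) (s : S) :
    Antitone fun k => (D ^ k *ᵥ 1) s := by
  refine antitone_nat_of_succ_le fun k => ?_
  induction k generalizing s with
  | zero => simpa using survival_le_one hD 1 s
  | succ k ih =>
    rw [survival_succ (k + 1), survival_succ k]
    exact sum_le_sum fun t _ => mul_le_mul_of_nonneg_left (ih t) (hD.nonneg s t)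

lemma killedLaw_apply_le_sum (hD : IsSubstochastic D) (hv : ∀ s, 0 ≤ v s) (k : ℕ) (s : S) :
    killedLaw v D k s ≤ ∑ t, killedLaw v D k t :=
  single_le_sum (f := killedLaw v D k) (fun t _ => killedLaw_nonneg hD hv k t) (mem_univ s)

namespace FiniteLifetime

lemma summable_apply (h : FiniteLifetime v D) (hD : IsSubstochastic D) (hv : ∀ s, 0 ≤ v s)
    (s : S) : Summable fun k => killedLaw v D k s :=
  Summable.of_nonneg_of_le (fun k => killedLaw_nonneg hD hv k s)
    (fun k => killedLaw_apply_le_sum hD hv k s) h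

lemma hasSum_dot (h : FiniteLifetime v D) (hD : IsSubstochastic D) (hv : ∀ s, 0 ≤ v s)
    (f : S → ℝ) :
    HasSum (fun k => ∑ s, killedLaw v D k s * f s) (∑ s, occupation v D s * f s) :=
  hasSum_sum fun s _ => (h.summable_apply hD hv s).hasSum.mul_right (f s)

lemma killedLaw_le_occupation (h : FiniteLifetime v D) (hD : IsSubstochastic D)
    (hv : ∀ s, 0 ≤ v s) (k : ℕ) (s : S) : killedLaw v D k s ≤ occupation v D s :=
  (h.summable_apply hD hv s).le_tsum k fun l _ => killedLaw_nonneg hD hv l s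

lemma occupation_eq (h : FiniteLifetime v D) (hD : IsSubstochastic D) (hv : ∀ s, 0 ≤ v s)
    (t : S) : occupation v D t = v t + ∑ s, occupation v D s * D s t := by
  have h1 := (h.summable_apply hD hv t).tsum_eq_zero_add
  rw [killedLaw_zero] at h1
  rw [occupation, h1]
  congr 1
  simp_rw [killedLaw_succ_apply]
  exact (h.hasSum_dot hD hv fun s => D s t).tsum_eq

/-- Balance equation of the occupation vector, tested against an arbitrary function. -/
lemma sum_occupation_mul_sub (h : FiniteLifetime v D) (hD : IsSubstochastic D)
    (hv : ∀ s, 0 ≤ v s) (V : S → ℝ) :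
    ∑ s, occupation v D s * (V s - (D *ᵥ V) s) = ∑ s, v s * V s := by
  have h1 : ∑ s, occupation v D s * (D *ᵥ V) s
      = ∑ t, (∑ s, occupation v D s * D s t) * V t := by
    simp only [mulVec, dotProduct, mul_sum, sum_mul, mul_assoc]
    exact sum_comm
  simp_rw [mul_sub]
  rw [sum_sub_distrib, h1, ← sum_sub_distrib]
  refine sum_congr rfl fun t _ => ?_
  rw [h.occupation_eq hD hv t]
  ring

end FiniteLifetime

lemma occupation_nonneg (hD : IsSubstochastic D) (hv : ∀ s, 0 ≤ v s) (s : S) :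
    0 ≤ occupation v D s := tsum_nonneg fun k => killedLaw_nonneg hD hv k s

lemma exists_killedLaw_pos (hD : IsSubstochastic D) (hv : ∀ s, 0 ≤ v s) {s : S}
    (hs : 0 < occupation v D s) : ∃ k, 0 < killedLaw v D k s := by
  by_contra! hc
  have : ∀ k, killedLaw v D k s = 0 := fun k => le_antisymm (hc k) (killedLaw_nonneg hD hv k s)
  simp [occupation, this] at hs

/-- A set that contains the initial states and is closed under transitions contains all states
visited by the killed chain. -/
lemma mem_of_killedLaw_pos (hD : IsSubstochastic D) (hv : ∀ s, 0 ≤ v s) {R : S → Prop}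
    (h0 : ∀ s, 0 < v s → R s) (h1 : ∀ s t, R s → 0 < D s t → R t) {k : ℕ} {s : S}
    (hs : 0 < killedLaw v D k s) : R s := by
  induction k generalizing s with
  | zero => rw [killedLaw_zero] at hs; exact h0 s hs
  | succ k ih =>
    rw [killedLaw_succ_apply] at hs
    obtain ⟨t, -, ht⟩ := exists_lt_of_sum_lt (s := univ) (f := fun _ => (0 : ℝ)) (by simpa using hs)
    have h2 : 0 < killedLaw v D k t := by
      refine (killedLaw_nonneg hD hv k t).lt_of_ne fun h => ?_
      rw [← h] at ht; simp at ht
    exact h1 t s (ih h2) (pos_of_mul_pos_right ht h2.le)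

lemma mem_of_occupation_pos (hD : IsSubstochastic D) (hv : ∀ s, 0 ≤ v s) {R : S → Prop}
    (h0 : ∀ s, 0 < v s → R s) (h1 : ∀ s t, R s → 0 < D s t → R t) {s : S}
    (hs : 0 < occupation v D s) : R s :=
  let ⟨_, hk⟩ := exists_killedLaw_pos hD hv hs
  mem_of_killedLaw_pos hD hv h0 h1 hk

namespace FiniteLifetime

lemma occupation_pos_of_pos (h : FiniteLifetime v D) (hD : IsSubstochastic D)
    (hv : ∀ s, 0 ≤ v s) {s : S} (hs : 0 < v s) : 0 < occupation v D s :=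
  hs.trans_le (by simpa [killedLaw_zero] using h.killedLaw_le_occupation hD hv 0 s)

lemma occupation_pos_step (h : FiniteLifetime v D) (hD : IsSubstochastic D)
    (hv : ∀ s, 0 ≤ v s) {s t : S} (hs : 0 < occupation v D s) (hst : 0 < D s t) :
    0 < occupation v D t := by
  rw [h.occupation_eq hD hv t]
  have : occupation v D s * D s t ≤ ∑ s, occupation v D s * D s t :=
    single_le_sum (f := fun s => occupation v D s * D s t)
      (fun u _ => mul_nonneg (occupation_nonneg hD hv u) (hD.nonneg u t)) (mem_univ s)
  have := mul_pos hs hst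
  linarith [hv t]

end FiniteLifetime

/-- A Lyapunov function that decreases by at least one in expectation along the visited states
bounds the expected lifetime. -/
lemma finiteLifetime_of_lyapunov (hD : IsSubstochastic D) (hv : ∀ s, 0 ≤ v s) {R : S → Prop}
    (h0 : ∀ s, 0 < v s → R s) (h1 : ∀ s t, R s → 0 < D s t → R t) (W : S → ℝ)
    (hW0 : ∀ s, 0 ≤ W s) (hW : ∀ s, R s → 1 + (D *ᵥ W) s ≤ W s) : FiniteLifetime v D := by
  have key : ∀ k, ∑ s, killedLaw v D k s + ∑ s, killedLaw v D (k + 1) s * W s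
      ≤ ∑ s, killedLaw v D k s * W s := by
    intro k
    have e : ∑ s, killedLaw v D (k + 1) s * W s = ∑ s, killedLaw v D k s * (D *ᵥ W) s := by
      have := dotProduct_mulVec (killedLaw v D k) D W
      rw [← killedLaw_succ] at this
      exact this.symm
    rw [e, ← sum_add_distrib]
    refine sum_le_sum fun s _ => ?_
    rcases (killedLaw_nonneg hD hv k s).eq_or_lt with h | h
    · simp [← h]
    · have := mul_le_mul_of_nonneg_left (hW s (mem_of_killedLaw_pos hD hv h0 h1 h)) h.le
      linarith
  refine summable_of_sum_range_le (c := ∑ s, v s * W s)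
    (fun k => sum_nonneg fun s _ => killedLaw_nonneg hD hv k s) fun m => ?_
  have : ∑ k ∈ range m, ∑ s, killedLaw v D k s + ∑ s, killedLaw v D m s * W s
      ≤ ∑ s, v s * W s := by
    induction m with
    | zero => simp [killedLaw_zero]
    | succ m ih => rw [sum_range_succ]; linarith [key m]
  have h2 : 0 ≤ ∑ s, killedLaw v D m s * W s :=
    sum_nonneg fun s _ => mul_nonneg (killedLaw_nonneg hD hv m s) (hW0 s)
  linarith

lemma abs_pow_mulVec_le (hD : IsSubstochastic D) {f : S → ℝ} {C : ℝ} (hf : ∀ s, |f s| ≤ C)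
    (k : ℕ) (s : S) : |(D ^ k *ᵥ f) s| ≤ C * (D ^ k *ᵥ 1) s := by
  simp only [mulVec, dotProduct, Pi.one_apply, mul_one, mul_sum]
  refine (abs_sum_le_sum_abs _ _).trans (sum_le_sum fun t _ => ?_)
  rw [abs_mul, abs_of_nonneg (pow_nonneg_of_substochastic hD k s t), mul_comm]
  exact mul_le_mul_of_nonneg_right (hf t) (pow_nonneg_of_substochastic hD k s t)

namespace FiniteLifetime

lemma summable_pow_mulVec (h : FiniteLifetime v D) (hD : IsSubstochastic D)
    (hv : ∀ s, 0 ≤ v s) (f : S → ℝ) {s : S} (hs : 0 < occupation v D s) :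
    Summable fun k => (D ^ k *ᵥ f) s := by
  obtain ⟨j, hj⟩ := exists_killedLaw_pos hD hv hs
  have h1 : Summable fun k => (D ^ k *ᵥ 1) s := by
    have h2 : Summable fun k => (killedLaw v D j s)⁻¹ * ∑ t, killedLaw v D (j + k) t := by
      refine Summable.mul_left _ ?_
      simpa [add_comm j] using (summable_nat_add_iff j).2 h
    refine Summable.of_nonneg_of_le (fun k => survival_nonneg hD k s) (fun k => ?_) h2
    rw [inv_mul_eq_div, le_div_iff₀ hj, sum_killedLaw_add, mul_comm]
    exact single_le_sum (f := fun t => killedLaw v D j t * (D ^ k *ᵥ 1) t)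
      (fun t _ => mul_nonneg (killedLaw_nonneg hD hv j t) (survival_nonneg hD k t)) (mem_univ s)
  refine Summable.of_norm_bounded (h1.mul_left (∑ t, |f t|)) fun k => ?_
  rw [Real.norm_eq_abs]
  exact abs_pow_mulVec_le hD
    (fun t => single_le_sum (f := fun t => |f t|) (fun _ _ => abs_nonneg _) (mem_univ t)) k s

/-- The potential of `f` solves the Poisson equation at the visited states. -/
lemma potential_eq (h : FiniteLifetime v D) (hD : IsSubstochastic D) (hv : ∀ s, 0 ≤ v s)
    (f : S → ℝ) {s : S} (hs : 0 < occupation v D s) :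
    potential D f s = f s + (D *ᵥ potential D f) s := by
  have h1 := (h.summable_pow_mulVec hD hv f hs).tsum_eq_zero_add
  rw [potential, h1]
  simp only [pow_zero, one_mulVec, add_right_inj]
  have h2 : ∀ t, HasSum (fun k => D s t * (D ^ k *ᵥ f) t) (D s t * potential D f t) := by
    intro t
    rcases (hD.nonneg s t).eq_or_lt with h0 | h0
    · simp [← h0, hasSum_zero]
    · exact (h.summable_pow_mulVec hD hv f (h.occupation_pos_step hD hv hs h0)).hasSum.mul_left _
  have h3 := (hasSum_sum fun t (_ : t ∈ univ) => h2 t).tsum_eq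
  simp only [pow_succ'] at h3 ⊢
  rw [show (D *ᵥ potential D f) s = ∑ t, D s t * potential D f t from rfl, ← h3]
  refine tsum_congr fun k => ?_
  rw [← mulVec_mulVec]; rfl

lemma potential_one_nonneg (hD : IsSubstochastic D) (s : S) : 0 ≤ potential D 1 s :=
  tsum_nonneg fun k => survival_nonneg hD k s

lemma sum_occupation_mul (h : FiniteLifetime v D) (hD : IsSubstochastic D)
    (hv : ∀ s, 0 ≤ v s) (f : S → ℝ) :
    ∑ s, occupation v D s * f s = ∑ s, v s * potential D f s := by
  rw [← h.sum_occupation_mul_sub hD hv]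
  refine sum_congr rfl fun s _ => ?_
  rcases (occupation_nonneg hD hv s).eq_or_lt with h0 | h0
  · simp [← h0]
  · rw [h.potential_eq hD hv f h0]; ring

/-- A finite nonnegative solution of the balance equation with source `c • v` that lives on visited
states is `c` times the occupation vector. -/
lemma eq_mul_occupation (h : FiniteLifetime v D) (hD : IsSubstochastic D) (hv : ∀ s, 0 ≤ v s)
    {y : S → ℝ} {c : ℝ} (hy0 : ∀ s, 0 ≤ y s)
    (hy : ∀ t, y t = c * v t + ∑ s, y s * D s t)
    (hsupp : ∀ s, 0 < y s → 0 < occupation v D s) (s : S) : y s = c * occupation v D s := by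
  -- The difference `z` is invariant under `D`, hence stays below the mass of `y` after `k` steps,
  -- which tends to zero.
  set z : S → ℝ := fun s => y s - c * occupation v D s with hz
  have hzD : ∀ k, z ᵥ* D ^ k = z := by
    intro k
    induction k with
    | zero => simp
    | succ k ih =>
      rw [pow_succ, ← vecMul_vecMul, ih]
      ext t
      have e : (z ᵥ* D) t = ∑ s, y s * D s t - c * ∑ s, occupation v D s * D s t := by
        simp only [vecMul, dotProduct, hz, sub_mul, sum_sub_distrib, mul_sum, mul_assoc]
      rw [e]
      simp only [hz]
      linarith [hy t, congrArg (c * ·) (h.occupation_eq hD hv t)]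
  have hlim : ∀ t, Filter.Tendsto (fun k => (z ᵥ* D ^ k) t) Filter.atTop (nhds 0) := by
    intro t
    have e : ∀ k, (z ᵥ* D ^ k) t = ∑ s, z s * (D ^ k *ᵥ Pi.single t 1) s := by
      intro k
      simp only [vecMul, dotProduct, mulVec_single_one]; rfl
    simp_rw [e]
    have : (0 : ℝ) = ∑ s : S, 0 := by simp
    rw [this]
    refine tendsto_finsetSum _ fun s _ => ?_
    rcases (occupation_nonneg hD hv s).eq_or_lt with h0 | h0
    · have hy' : y s = 0 := by
        by_contra hne
        exact (hsupp s ((hy0 s).lt_of_ne' hne)).ne h0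
      simp [hz, ← h0, hy']
    · simpa using
        (h.summable_pow_mulVec hD hv (Pi.single t 1) h0).tendsto_atTop_zero.const_mul (z s)
  have : z s = 0 := by
    have := hlim s
    simp_rw [hzD] at this
    exact tendsto_nhds_unique tendsto_const_nhds this
  simpa [hz, sub_eq_zero] using this

end FiniteLifetime

/-! ### Decomposition of the killed chain according to whether killing is possible -/

/-- The states from which the killed chain survives forever with probability one. -/
def Immortal (D : Matrix S S ℝ) (s : S) : Prop := ∀ k, (D ^ k *ᵥ 1) s = 1

lemma Immortal.step (hD : IsSubstochastic D) {s t : S} (hs : Immortal D s) (hst : 0 < D s t) :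
    Immortal D t := by
  intro k
  refine le_antisymm (survival_le_one hD k t) ?_
  by_contra! hlt
  have h1 := hs (k + 1)
  rw [survival_succ] at h1
  have : ∑ t, D s t * (D ^ k *ᵥ 1) t < ∑ t, D s t :=
    sum_lt_sum (fun u _ => mul_le_of_le_one_right (hD.nonneg s u) (survival_le_one hD k u))
      ⟨t, mem_univ t, by nlinarith⟩
  linarith [hD.row_le s]

/-- The mass on states from which killing is possible. -/
def mortalMass (v : S → ℝ) (D : Matrix S S ℝ) (k : ℕ) : ℝ :=
  ∑ s, if Immortal D s then 0 else killedLaw v D k s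

/-- The mass on states from which killing is impossible. -/
def immortalMass (v : S → ℝ) (D : Matrix S S ℝ) (k : ℕ) : ℝ :=
  ∑ s, if Immortal D s then killedLaw v D k s else 0

lemma mortalMass_add_immortalMass (k : ℕ) :
    mortalMass v D k + immortalMass v D k = ∑ s, killedLaw v D k s := by
  rw [mortalMass, immortalMass, ← sum_add_distrib]
  refine sum_congr rfl fun s _ => ?_
  split_ifs <;> simp

lemma mortalMass_nonneg (hD : IsSubstochastic D) (hv : ∀ s, 0 ≤ v s) (k : ℕ) :
    0 ≤ mortalMass v D k :=
  sum_nonneg fun s _ => by split_ifs; exacts [le_rfl, killedLaw_nonneg hD hv k s]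

lemma immortalMass_nonneg (hD : IsSubstochastic D) (hv : ∀ s, 0 ≤ v s) (k : ℕ) :
    0 ≤ immortalMass v D k :=
  sum_nonneg fun s _ => by split_ifs; exacts [killedLaw_nonneg hD hv k s, le_rfl]

lemma immortalMass_le (hD : IsSubstochastic D) (hv : ∀ s, 0 ≤ v s) (k l : ℕ) :
    immortalMass v D k ≤ immortalMass v D (k + l) := by
  induction l with
  | zero => rfl
  | succ l ih =>
    refine ih.trans ?_
    rw [← add_assoc]
    set m := k + l
    simp only [immortalMass]
    simp_rw [killedLaw_succ_apply]
    have : ∀ t, (if Immortal D t then ∑ s, killedLaw v D m s * D s t else 0)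
        ≥ ∑ s, if Immortal D s then killedLaw v D m s * D s t else 0 := by
      intro t
      split_ifs with ht
      · exact sum_le_sum fun s _ => by
          split_ifs; exacts [le_rfl, mul_nonneg (killedLaw_nonneg hD hv m s) (hD.nonneg s t)]
      · refine (sum_eq_zero fun s _ => ?_).le
        split_ifs with hs
        · have : D s t = 0 := by
            by_contra hne
            exact ht (hs.step hD ((hD.nonneg s t).lt_of_ne' hne))
          simp [this]
        · rfl
    refine le_trans ?_ (sum_le_sum fun t _ => this t)
    rw [sum_comm]
    refine sum_le_sum fun s _ => ?_
    split_ifs with hs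
    · rw [← mul_sum]
      have h1 := hs 1
      rw [survival_succ] at h1
      simp only [pow_zero, one_mulVec, Pi.one_apply, mul_one] at h1
      simp [h1]
    · simp

lemma exists_survival_lt (hD : IsSubstochastic D) :
    ∃ K, ∃ θ < (1 : ℝ), 0 ≤ θ ∧ ∀ s, ¬ Immortal D s → (D ^ K *ᵥ 1) s ≤ θ := by
  have h1 : ∀ s, ∃ k, ¬ Immortal D s → (D ^ k *ᵥ 1) s < 1 := by
    intro s
    by_cases hs : Immortal D s
    · exact ⟨0, fun h => (h hs).elim⟩
    · obtain ⟨k, hk⟩ := not_forall.1 hs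
      exact ⟨k, fun _ => (survival_le_one hD k s).lt_of_ne hk⟩
  choose k hk using h1
  set K := univ.sup k
  have h2 : ∀ s, ¬ Immortal D s → (D ^ K *ᵥ 1) s < 1 := fun s hs =>
    (survival_antitone hD s (le_sup (f := k) (mem_univ s))).trans_lt (hk s hs)
  have h3 : ∃ θ < (1 : ℝ), ∀ s ∈ univ.filter (fun s => ¬ Immortal D s), (D ^ K *ᵥ 1) s ≤ θ := by
    rcases (univ.filter (fun s => ¬ Immortal D s)).eq_empty_or_nonempty with he | hne
    · exact ⟨0, one_pos, by simp [he]⟩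
    · obtain ⟨s, hs, hmax⟩ := exists_max_image _ (fun s => (D ^ K *ᵥ 1) s) hne
      exact ⟨_, h2 s (mem_filter.1 hs).2, hmax⟩
  obtain ⟨θ, hθ, h4⟩ := h3
  exact ⟨K, max θ 0, max_lt hθ one_pos, le_max_right _ _, fun s hs =>
    (h4 s (by simp [hs])).trans (le_max_left _ _)⟩

/-- The mass on states from which killing is possible decays geometrically. -/
lemma summable_mortalMass (hD : IsSubstochastic D) (hv : ∀ s, 0 ≤ v s) :
    Summable (mortalMass v D) := by
  obtain ⟨K, θ, hθ1, hθ0, hθ⟩ := exists_survival_lt hD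
  have step : ∀ k, mortalMass v D (k + K) ≤ θ * mortalMass v D k := by
    intro k
    have h1 : ∑ s, killedLaw v D (k + K) s ≤ θ * mortalMass v D k + immortalMass v D k := by
      rw [sum_killedLaw_add, mortalMass, immortalMass, mul_sum, ← sum_add_distrib]
      refine sum_le_sum fun s _ => ?_
      split_ifs with hs
      · simp [hs K]
      · have := mul_le_mul_of_nonneg_left (hθ s hs) (killedLaw_nonneg hD hv k s)
        linarith
    have h2 := immortalMass_le hD hv k K
    have h3 := mortalMass_add_immortalMass (v := v) (D := D) (k + K)
    linarith
  have hnn := mortalMass_nonneg hD hv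
  refine summable_of_sum_range_le (c := (∑ k ∈ range K, mortalMass v D k) / (1 - θ)) hnn
    fun m => ?_
  rw [le_div_iff₀ (by linarith)]
  have h1 : ∑ k ∈ range m, mortalMass v D k ≤ ∑ k ∈ range (m + K), mortalMass v D k :=
    sum_le_sum_of_subset_of_nonneg (range_mono (by omega)) fun k _ _ => hnn k
  have h2 : ∑ k ∈ range (m + K), mortalMass v D k
      ≤ ∑ k ∈ range K, mortalMass v D k + θ * ∑ k ∈ range m, mortalMass v D k := by
    rw [add_comm m K, sum_range_add, mul_sum]
    gcongr with k
    rw [add_comm]; exact step k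
  linarith

/-- If the expected lifetime is infinite, then with positive probability the chain reaches a state
from which it cannot be killed. -/
lemma exists_immortalMass_pos (hD : IsSubstochastic D) (hv : ∀ s, 0 ≤ v s)
    (h : ¬ FiniteLifetime v D) : ∃ k, 0 < immortalMass v D k := by
  by_contra! hc
  refine h ((summable_mortalMass hD hv).congr fun k => ?_)
  rw [← mortalMass_add_immortalMass k, le_antisymm (hc k) (immortalMass_nonneg hD hv k), add_zero]

end KilledChain

end

noncomputable section

open Finset MeasureTheory ProbabilityTheory

/-! ### Integrals of functions of finitely many path steps -/

instance {S Act : Type*} [Finite S] [Finite Act] : Finite (PathStep S Act) :=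
  Finite.of_injective (fun x : PathStep S Act => (x.state, x.act)) fun x y h => by
    cases x; cases y; simpa using h

lemma PMF.tsum_bind_mul {α β : Type*} (p : PMF α) (q : α → PMF β) (f : β → ℝ≥0∞) :
    ∑' b, p.bind q b * f b = ∑' a, p a * ∑' b, q a b * f b := by
  simp_rw [PMF.bind_apply, ← ENNReal.tsum_mul_right]
  rw [ENNReal.tsum_comm]
  simp_rw [mul_assoc, ENNReal.tsum_mul_left]

lemma PMF.tsum_pure_mul {α : Type*} (a : α) (f : α → ℝ≥0∞) :
    ∑' b, PMF.pure a b * f b = f a := by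
  rw [tsum_eq_single a fun b hb => by simp [PMF.pure_apply, hb]]
  simp

lemma PMF.lintegral_toMeasure {α : Type*} [MeasurableSpace α] [Countable α]
    [MeasurableSingletonClass α] (p : PMF α) (f : α → ℝ≥0∞) :
    ∫⁻ a, f a ∂p.toMeasure = ∑' a, p a * f a := by
  rw [lintegral_countable']
  refine tsum_congr fun a => ?_
  rw [PMF.toMeasure_apply_singleton _ _ (measurableSet_singleton a), mul_comm]

section Trajectory

open Kernel Preorder

variable {X : ℕ → Type*} [∀ n, MeasurableSpace (X n)] {μ₀ : Measure (X 0)}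
  [IsProbabilityMeasure μ₀] {κ : (n : ℕ) → Kernel (Π i : Iic n, X i) (X (n + 1))}
  [∀ n, IsMarkovKernel (κ n)]

omit [IsProbabilityMeasure μ₀] in
lemma lintegral_trajMeasure_zero {f : X 0 → ℝ≥0∞} (hf : Measurable f) :
    ∫⁻ x, f (x 0) ∂trajMeasure μ₀ κ = ∫⁻ y, f y ∂μ₀ := by
  have h : (trajMeasure μ₀ κ).map (frestrictLe 0)
      = μ₀.map (MeasurableEquiv.piUnique (fun i : Iic 0 ↦ X i)).symm := by
    rw [trajMeasure, Measure.map_comp _ _ (by fun_prop), traj_map_frestrictLe, partialTraj_self]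
    exact Measure.id_comp
  have hm : Measurable fun h : Π i : Iic 0, X i => f (h ⟨0, by simp⟩) :=
    hf.comp (measurable_pi_apply _)
  calc ∫⁻ x, f (x 0) ∂trajMeasure μ₀ κ
      = ∫⁻ h : Π i : Iic 0, X i, f (h ⟨0, by simp⟩) ∂(trajMeasure μ₀ κ).map (frestrictLe 0) := by
        rw [lintegral_map hm (by fun_prop)]; rfl
    _ = _ := by
        rw [h]
        exact lintegral_map hm (MeasurableEquiv.measurable _)

lemma lintegral_trajMeasure_succ (k : ℕ) {f : (Π i : Iic k, X i) × X (k + 1) → ℝ≥0∞}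
    (hf : Measurable f) :
    ∫⁻ x, f (frestrictLe k x, x (k + 1)) ∂trajMeasure μ₀ κ
      = ∫⁻ x, ∫⁻ y, f (frestrictLe k x, y) ∂κ k (frestrictLe k x) ∂trajMeasure μ₀ κ := by
  calc _ = ∫⁻ z, f z ∂(trajMeasure μ₀ κ).map (fun x ↦ (frestrictLe k x, x (k + 1))) := by
        rw [lintegral_map hf (by fun_prop)]
    _ = _ := by
        rw [← map_frestrictLe_trajMeasure_compProd_eq_map_trajMeasure,
          Measure.lintegral_compProd hf,
          lintegral_map (hf.lintegral_kernel_prod_right') (by fun_prop)]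

end Trajectory

namespace MDP.Scheduler

variable {S Act AP : Type*} [Fintype S] {M : MDP S Act AP}

/-- The transition probabilities of the Markov chain induced on the states. -/
def trans (μ : M.Scheduler) (s : S) : PMF S := (μ.choice s).bind (M.next s)

open Classical in
/-- The transition matrix of the induced chain, killed on entering `B`. -/
def killedMatrix (μ : M.Scheduler) (B : Set AP → Prop) : Matrix S S ℝ :=
  fun s t => if B (M.L t) then 0 else (μ.trans s t).toReal

open Classical in
/-- The initial distribution of the chain killed on entering `B`: it is zero if the initial state
already satisfies `B`. -/
def killedInit (M : MDP S Act AP) (B : Set AP → Prop) (s : S) : ℝ :=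
  if s = M.init ∧ ¬ B (M.L s) then 1 else 0

lemma killedInit_nonneg (B : Set AP → Prop) (s : S) : 0 ≤ killedInit M B s := by
  rw [killedInit]; split_ifs <;> simp

lemma sum_toReal_pmf {α : Type*} [Fintype α] (p : PMF α) : ∑ a, (p a).toReal = 1 := by
  rw [← ENNReal.toReal_sum fun a _ => p.apply_ne_top a, ← tsum_fintype (L := .unconditional _),
    p.tsum_coe, ENNReal.toReal_one]

lemma isSubstochastic_killedMatrix (μ : M.Scheduler) (B : Set AP → Prop) :
    IsSubstochastic (μ.killedMatrix B) where
  nonneg s t := by rw [killedMatrix]; split_ifs <;> simp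
  row_le s := by
    rw [← sum_toReal_pmf (μ.trans s)]
    refine sum_le_sum fun t _ => ?_
    rw [killedMatrix]; split_ifs <;> simp

/-- The distribution of the current state on the event that `B` has not been reached yet. -/
abbrev law (μ : M.Scheduler) (B : Set AP → Prop) (k : ℕ) : S → ℝ :=
  killedLaw (killedInit M B) (μ.killedMatrix B) k

/-- The expected number of visits before `B` is reached. -/
abbrev occ (μ : M.Scheduler) (B : Set AP → Prop) : S → ℝ :=
  occupation (killedInit M B) (μ.killedMatrix B)

/-- The expected hitting time of `B` is finite. -/
abbrev FiniteHitting (μ : M.Scheduler) (B : Set AP → Prop) : Prop :=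
  FiniteLifetime (killedInit M B) (μ.killedMatrix B)

lemma law_nonneg (μ : M.Scheduler) (B : Set AP → Prop) (k : ℕ) (s : S) : 0 ≤ μ.law B k s :=
  killedLaw_nonneg (μ.isSubstochastic_killedMatrix B) (killedInit_nonneg B) k s

instance : IsProbabilityMeasure (pathMeasure (M := M) (μ : M.Scheduler)) := by
  rw [pathMeasure]; infer_instance

/-- The paths that avoid `B` up to time `k`. -/
def alive (M : MDP S Act AP) (B : Set AP → Prop) (k : ℕ) : Set (ℕ → PathStep S Act) :=
  {π | ∀ l ≤ k, ¬ B (M.L (π l).state)}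

lemma measurableSet_alive (B : Set AP → Prop) (k : ℕ) : MeasurableSet (alive M B k) := by
  have : alive M B k =
      ⋂ l ≤ k, (fun π : ℕ → PathStep S Act => π l) ⁻¹' {x | ¬ B (M.L x.state)} := by
    ext π; simp [alive]
  rw [this]
  exact MeasurableSet.iInter fun l => MeasurableSet.iInter fun _ =>
    (measurable_pi_apply l) (MeasurableSet.of_discrete)

variable [Fintype Act]

/-- The mean of a function of the next action. -/
def actMean (μ : M.Scheduler) (s : S) (f : Option Act → ℝ) : ℝ :=
  ∑ o, (μ.choice s o).toReal * f o

lemma lintegral_stepAt (μ : M.Scheduler) (s : S) (f : PathStep S Act → ℝ≥0∞) :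
    ∫⁻ x, f x ∂(μ.stepAt s).toMeasure = ∑ o, μ.choice s o * f ⟨s, o⟩ := by
  rw [PMF.lintegral_toMeasure, stepAt, PMF.map, PMF.tsum_bind_mul]
  simp_rw [Function.comp, PMF.tsum_pure_mul]
  rw [tsum_fintype]

lemma lintegral_kernel (μ : M.Scheduler) (x : PathStep S Act) (f : PathStep S Act → ℝ≥0∞) :
    ∫⁻ y, f y ∂μ.kernel x
      = ∑ t, M.next x.state x.act t * ∑ o, μ.choice t o * f ⟨t, o⟩ := by
  change ∫⁻ y, f y ∂((M.next x.state x.act).bind μ.stepAt).toMeasure = _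
  rw [PMF.lintegral_toMeasure, PMF.tsum_bind_mul, tsum_fintype]
  refine sum_congr rfl fun t _ => ?_
  rw [← lintegral_stepAt, PMF.lintegral_toMeasure]

lemma ofReal_killedMatrix (μ : M.Scheduler) (B : Set AP → Prop) (s t : S) [Decidable (B (M.L t))] :
    ENNReal.ofReal (μ.killedMatrix B s t)
      = if B (M.L t) then 0 else ∑ o, μ.choice s o * M.next s o t := by
  rw [killedMatrix]
  split_ifs
  · simp
  · rw [ENNReal.ofReal_toReal (PMF.apply_ne_top _ _), trans, PMF.bind_apply, tsum_fintype]

/-- The law of the path step at time `k` on the event that `B` has not been reached. -/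
lemma lintegral_alive (μ : M.Scheduler) (B : Set AP → Prop) (k : ℕ)
    (f : PathStep S Act → ℝ≥0∞) :
    ∫⁻ π, (alive M B k).indicator (fun π => f (π k)) π ∂μ.pathMeasure
      = ∑ s, ENNReal.ofReal (μ.law B k s) * ∑ o, μ.choice s o * f ⟨s, o⟩ := by
  classical
  induction k generalizing f with
  | zero =>
    have h1 : ∀ π : ℕ → PathStep S Act, (alive M B 0).indicator (fun π => f (π 0)) π
        = (fun x : PathStep S Act => if B (M.L x.state) then 0 else f x) (π 0) := by
      intro π
      by_cases h : B (M.L (π 0).state) <;> simp [alive, h]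
    rw [lintegral_congr h1, pathMeasure, lintegral_trajMeasure_zero (X := fun _ => PathStep S Act)
      (f := fun x => if B (M.L x.state) then 0 else f x) Measurable.of_discrete, lintegral_stepAt]
    rw [sum_eq_single M.init]
    · by_cases h : B (M.L M.init) <;> simp [law, killedLaw_zero, killedInit, h]
    · intro s _ hs
      simp [law, killedLaw_zero, killedInit, hs]
    · simp
  | succ k ih =>
    set g : PathStep S Act → ℝ≥0∞ := fun x =>
      ∑ t, M.next x.state x.act t * ∑ o, μ.choice t o * if B (M.L t) then 0 else f ⟨t, o⟩ with hg
    have h1 : ∫⁻ π, (alive M B (k + 1)).indicator (fun π => f (π (k + 1))) π ∂μ.pathMeasure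
        = ∫⁻ π, (alive M B k).indicator (fun π => g (π k)) π ∂μ.pathMeasure := by
      set F : (Π _ : Iic k, PathStep S Act) × PathStep S Act → ℝ≥0∞ := fun z =>
        if ∀ l : Iic k, ¬ B (M.L (z.1 l).state) then
          (if B (M.L z.2.state) then 0 else f z.2) else 0 with hF
      have e1 : ∀ π : ℕ → PathStep S Act,
          (alive M B (k + 1)).indicator (fun π => f (π (k + 1))) π
            = F (Preorder.frestrictLe k π, π (k + 1)) := by
        intro π
        have hF' : F (Preorder.frestrictLe k π, π (k + 1)) = if ∀ l : Iic k, ¬ B (M.L (π l).state)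
            then (if B (M.L (π (k + 1)).state) then 0 else f (π (k + 1))) else 0 := rfl
        rw [hF']
        by_cases h : ∀ l : Iic k, ¬ B (M.L (π l).state)
        · rw [if_pos h]
          by_cases h' : B (M.L (π (k + 1)).state)
          · have hn : π ∉ alive M B (k + 1) := fun hc => hc (k + 1) le_rfl h'
            rw [Set.indicator_of_notMem hn, if_pos h']
          · rw [Set.indicator_of_mem, if_neg h']
            intro l hl
            rcases Nat.le_succ_iff.1 hl with hl | rfl
            exacts [h ⟨l, mem_Iic.2 hl⟩, h']
        · rw [if_neg h, Set.indicator_of_notMem]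
          exact fun hc => h fun l => hc l ((mem_Iic.1 l.2).trans k.le_succ)
      simp_rw [e1]
      have hFm : Measurable F := Measurable.of_discrete
      rw [pathMeasure, lintegral_trajMeasure_succ (X := fun _ => PathStep S Act) k hFm]
      refine lintegral_congr fun π => ?_
      change ∫⁻ y, F (Preorder.frestrictLe k π, y) ∂μ.kernel (π k) = _
      rw [lintegral_kernel]
      by_cases h : π ∈ alive M B k
      · rw [Set.indicator_of_mem h]
        have : ∀ l : Iic k, ¬ B (M.L (Preorder.frestrictLe (π := fun _ => PathStep S Act) k π
          l).state) := fun l => h l (mem_Iic.1 l.2)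
        simp only [hF, if_pos this, hg]
      · rw [Set.indicator_of_notMem h]
        have : ¬ ∀ l : Iic k, ¬ B (M.L (Preorder.frestrictLe (π := fun _ => PathStep S Act) k π
          l).state) := fun hc => h fun l hl => hc ⟨l, mem_Iic.2 hl⟩
        simp only [hF, if_neg this, mul_zero, sum_const_zero]
    rw [h1, ih g]
    have h2 : ∀ t, ENNReal.ofReal (μ.law B (k + 1) t)
        = ∑ s, ENNReal.ofReal (μ.law B k s) * ENNReal.ofReal (μ.killedMatrix B s t) := by
      intro t
      rw [law, killedLaw_succ_apply, ENNReal.ofReal_sum_of_nonneg]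
      · exact sum_congr rfl fun s _ => ENNReal.ofReal_mul (μ.law_nonneg B k s)
      · exact fun s _ => mul_nonneg (μ.law_nonneg B k s)
          ((μ.isSubstochastic_killedMatrix B).nonneg s t)
    simp_rw [h2, sum_mul]
    rw [sum_comm]
    refine sum_congr rfl fun s _ => ?_
    simp_rw [mul_assoc, ← mul_sum]
    congr 1
    simp_rw [ofReal_killedMatrix, hg, mul_sum]
    rw [sum_comm]
    refine sum_congr rfl fun t _ => ?_
    split_ifs with h
    · simp
    · rw [← mul_sum, sum_mul_sum]
      exact sum_congr rfl fun o _ => sum_congr rfl fun o' _ => (mul_assoc _ _ _).symm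

end MDP.Scheduler

end

noncomputable section

open Finset MeasureTheory ProbabilityTheory

/-! ### Reachability rewards as occupation averages -/

namespace MDP.Scheduler

variable {S Act AP : Type*} [Fintype S] {M : MDP S Act AP}

lemma mem_alive {B : Set AP → Prop} {k : ℕ} {π : ℕ → PathStep S Act} :
    π ∈ alive M B k ↔ ∀ l ≤ k, ¬ B (M.L (π l).state) := Iff.rfl

lemma alive_antitone (B : Set AP → Prop) : Antitone (alive M B) :=
  fun _ _ hkl _ h m hm => h m (hm.trans hkl)

open Classical in
lemma mem_alive_iff_lt_find {B : Set AP → Prop} {k : ℕ} {π : ℕ → PathStep S Act}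
    (h : ∃ k, B (M.L (π k).state)) : π ∈ alive M B k ↔ k < Nat.find h := by
  rw [mem_alive, Nat.lt_find_iff]

lemma notMem_iInter_alive {B : Set AP → Prop} {π : ℕ → PathStep S Act} :
    π ∉ ⋂ k, alive M B k ↔ ∃ k, B (M.L (π k).state) := by
  simp only [Set.mem_iInter, mem_alive, not_forall, not_not]
  exact ⟨fun ⟨k, l, _, h⟩ => ⟨l, h⟩, fun ⟨k, h⟩ => ⟨k, k, le_rfl, h⟩⟩

lemma pathReward_of_mem {ρ : S → Act → ℝ} {B : Set AP → Prop} {π : ℕ → PathStep S Act}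
    (h : π ∈ ⋂ k, alive M B k) : M.pathReward ρ B π = ⊤ := by
  rw [pathReward, dif_neg fun hc => notMem_iInter_alive.2 hc h]

/-- The reward collected in step `k` if `B` has not been reached up to then. -/
def aliveReward (M : MDP S Act AP) (ρ : S → Act → ℝ) (B : Set AP → Prop) (k : ℕ)
    (π : ℕ → PathStep S Act) : ℝ :=
  (alive M B k).indicator (fun π => stepReward ρ (π k)) π

lemma exists_hasSum_aliveReward {ρ : S → Act → ℝ} {B : Set AP → Prop}
    {π : ℕ → PathStep S Act} (h : π ∉ ⋂ k, alive M B k) :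
    ∃ m : ℕ, (∀ k, π ∈ alive M B k ↔ k < m) ∧
      M.pathReward ρ B π = ((∑ k ∈ range m, stepReward ρ (π k) : ℝ) : EReal) ∧
      HasSum (fun k => aliveReward M ρ B k π) (∑ k ∈ range m, stepReward ρ (π k)) := by
  classical
  have h' := notMem_iInter_alive.1 h
  refine ⟨Nat.find h', fun k => mem_alive_iff_lt_find h', ?_, ?_⟩
  · rw [pathReward, dif_pos h']
  · have e : ∑ k ∈ range (Nat.find h'), stepReward ρ (π k)
        = ∑ k ∈ range (Nat.find h'), aliveReward M ρ B k π := by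
      refine sum_congr rfl fun k hk => ?_
      rw [aliveReward, Set.indicator_of_mem ((mem_alive_iff_lt_find h').2 (mem_range.1 hk))]
    rw [e]
    refine hasSum_sum_of_ne_finset_zero fun k hk => ?_
    rw [aliveReward, Set.indicator_of_notMem]
    exact fun hc => hk (mem_range.2 ((mem_alive_iff_lt_find h').1 hc))

variable [Fintype Act]

lemma exists_stepReward_bound (ρ : S → Act → ℝ) :
    ∃ C : ℝ, 0 ≤ C ∧ ∀ x : PathStep S Act, |stepReward ρ x| ≤ C := by
  obtain ⟨C, hC⟩ := (Set.finite_range fun x : PathStep S Act => |stepReward ρ x|).bddAbove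
  exact ⟨max C 0, le_max_right _ _, fun x => (hC ⟨x, rfl⟩).trans (le_max_left _ _)⟩

omit [Fintype Act] in
lemma measurable_aliveReward (ρ : S → Act → ℝ) (B : Set AP → Prop) (k : ℕ) :
    Measurable (aliveReward M ρ B k) :=
  ((Measurable.of_discrete (f := stepReward ρ)).comp (measurable_pi_apply k)).indicator
    (measurableSet_alive B k)

lemma sum_choice (μ : M.Scheduler) (s : S) : ∑ o, μ.choice s o = 1 := by
  rw [← tsum_fintype (L := .unconditional _), PMF.tsum_coe]

lemma pathMeasure_alive (μ : M.Scheduler) (B : Set AP → Prop) (k : ℕ) :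
    μ.pathMeasure (alive M B k) = ENNReal.ofReal (∑ s, μ.law B k s) := by
  have h := μ.lintegral_alive B k fun _ => 1
  rw [lintegral_indicator (measurableSet_alive B k), setLIntegral_one] at h
  rw [h, ENNReal.ofReal_sum_of_nonneg fun s _ => μ.law_nonneg B k s]
  simp_rw [mul_one, sum_choice, mul_one]

lemma lintegral_ofReal_aliveReward (μ : M.Scheduler) (ρ : S → Act → ℝ) (B : Set AP → Prop)
    (k : ℕ) :
    ∫⁻ π, ENNReal.ofReal (aliveReward M ρ B k π) ∂μ.pathMeasure
      = ENNReal.ofReal (∑ s, μ.law B k s *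
          μ.actMean s fun o => max (stepReward ρ ⟨s, o⟩) 0) := by
  have h := μ.lintegral_alive B k fun x => ENNReal.ofReal (stepReward ρ x)
  have e : ∀ π, ENNReal.ofReal (aliveReward M ρ B k π)
      = (alive M B k).indicator (fun π => ENNReal.ofReal (stepReward ρ (π k))) π := by
    intro π
    by_cases hπ : π ∈ alive M B k <;> simp [aliveReward, hπ]
  have hnn : ∀ s, 0 ≤ μ.actMean s fun o => max (stepReward ρ ⟨s, o⟩) 0 := fun s =>
    sum_nonneg fun o _ => mul_nonneg ENNReal.toReal_nonneg (le_max_right _ _)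
  rw [lintegral_congr e, h, ENNReal.ofReal_sum_of_nonneg
    fun s _ => mul_nonneg (μ.law_nonneg B k s) (hnn s)]
  refine sum_congr rfl fun s _ => ?_
  rw [ENNReal.ofReal_mul (μ.law_nonneg B k s), actMean, ENNReal.ofReal_sum_of_nonneg
    fun o _ => mul_nonneg ENNReal.toReal_nonneg (le_max_right _ _)]
  congr 1
  refine sum_congr rfl fun o _ => ?_
  rw [ENNReal.ofReal_mul ENNReal.toReal_nonneg, ENNReal.ofReal_toReal (PMF.apply_ne_top _ _)]
  congr 1
  rw [max_comm, ENNReal.ofReal_max]; simp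

omit [Fintype Act] in
lemma abs_aliveReward_le {ρ : S → Act → ℝ} {C : ℝ} (hC : ∀ x : PathStep S Act, |stepReward ρ x| ≤ C)
    (B : Set AP → Prop) (k : ℕ) (π : ℕ → PathStep S Act) :
    |aliveReward M ρ B k π| ≤ (alive M B k).indicator (fun _ => C) π := by
  by_cases hπ : π ∈ alive M B k <;> simp [aliveReward, hπ, hC]

lemma integrable_aliveReward (μ : M.Scheduler) (ρ : S → Act → ℝ) (B : Set AP → Prop) (k : ℕ) :
    Integrable (aliveReward M ρ B k) μ.pathMeasure := by
  obtain ⟨C, hC0, hC⟩ := exists_stepReward_bound ρ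
  refine Integrable.of_bound (measurable_aliveReward ρ B k).aestronglyMeasurable C
    (Filter.Eventually.of_forall fun π => (abs_aliveReward_le hC B k π).trans ?_)
  exact Set.indicator_le_self' (fun _ _ => hC0) π

/-- The mean of the reward of the next step. -/
def meanReward (μ : M.Scheduler) (ρ : S → Act → ℝ) (s : S) : ℝ :=
  μ.actMean s fun o => stepReward ρ ⟨s, o⟩

lemma integral_aliveReward (μ : M.Scheduler) (ρ : S → Act → ℝ) (B : Set AP → Prop) (k : ℕ) :
    ∫ π, aliveReward M ρ B k π ∂μ.pathMeasure = ∑ s, μ.law B k s * μ.meanReward ρ s := by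
  have hneg : ∀ π, - aliveReward M ρ B k π = aliveReward M (fun s a => - ρ s a) B k π := by
    intro π
    have : ∀ x : PathStep S Act, stepReward (fun s a => - ρ s a) x = - stepReward ρ x := by
      rintro ⟨s, _ | a⟩ <;> simp [stepReward]
    by_cases hπ : π ∈ alive M B k <;> simp [aliveReward, hπ, this]
  have hnn : ∀ ρ : S → Act → ℝ, 0 ≤ ∑ s, μ.law B k s *
      μ.actMean s fun o => max (stepReward ρ ⟨s, o⟩) 0 := fun ρ =>
    sum_nonneg fun s _ => mul_nonneg (μ.law_nonneg B k s)
      (sum_nonneg fun o _ => mul_nonneg ENNReal.toReal_nonneg (le_max_right _ _))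
  rw [integral_eq_lintegral_pos_part_sub_lintegral_neg_part (μ.integrable_aliveReward ρ B k)]
  simp_rw [hneg]
  rw [lintegral_ofReal_aliveReward, lintegral_ofReal_aliveReward, ENNReal.toReal_ofReal (hnn _),
    ENNReal.toReal_ofReal (hnn _), ← sum_sub_distrib]
  refine sum_congr rfl fun s _ => ?_
  rw [← mul_sub, meanReward, actMean, actMean, actMean, ← sum_sub_distrib]
  congr 1
  refine sum_congr rfl fun o _ => ?_
  rw [← mul_sub]
  congr 1
  have : stepReward (fun s a => - ρ s a) ⟨s, o⟩ = - stepReward ρ ⟨s, o⟩ := by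
    cases o <;> simp [stepReward]
  rw [this]
  exact posPart_sub_negPart (stepReward ρ ⟨s, o⟩)

/-- If the expected hitting time is finite, then the reachability reward is the scalar product of
the expected numbers of visits with the mean rewards. -/
theorem reachReward_eq_of_finiteHitting (μ : M.Scheduler) (ρ : S → Act → ℝ) {B : Set AP → Prop}
    (h : μ.FiniteHitting B) :
    M.reachReward ρ B μ = ((∑ s, μ.occ B s * μ.meanReward ρ s : ℝ) : EReal) := by
  obtain ⟨C, hC0, hC⟩ := exists_stepReward_bound (Act := Act) ρ
  have hD := μ.isSubstochastic_killedMatrix B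
  have hv := killedInit_nonneg (M := M) B
  have hnull : μ.pathMeasure (⋂ k, alive M B k) = 0 := by
    have h1 : Filter.Tendsto (fun k => ENNReal.ofReal (∑ s, μ.law B k s)) Filter.atTop
        (nhds 0) := by
      rw [← ENNReal.ofReal_zero]
      exact (ENNReal.continuous_ofReal.tendsto 0).comp h.tendsto_atTop_zero
    refine le_antisymm (ge_of_tendsto' h1 fun k => ?_) zero_le
    rw [← pathMeasure_alive]
    exact measure_mono (Set.iInter_subset _ k)
  have hae : ∀ᵐ π ∂μ.pathMeasure, π ∉ ⋂ k, alive M B k := measure_eq_zero_iff_ae_notMem.1 hnull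
  set f : (ℕ → PathStep S Act) → ℝ := fun π => ∑' k, aliveReward M ρ B k π with hf
  have hfe : ∀ᵐ π ∂μ.pathMeasure, M.pathReward ρ B π = (f π : EReal) := by
    filter_upwards [hae] with π hπ
    obtain ⟨m, -, h1, h2⟩ := exists_hasSum_aliveReward (ρ := ρ) hπ
    rw [h1, hf, ← h2.tsum_eq]
  have hnorm : ∀ k, ∫ π, ‖aliveReward M ρ B k π‖ ∂μ.pathMeasure ≤ C * ∑ s, μ.law B k s := by
    intro k
    calc _ ≤ ∫ π, (alive M B k).indicator (fun _ => C) π ∂μ.pathMeasure :=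
          integral_mono (μ.integrable_aliveReward ρ B k).norm
            ((integrable_const C).indicator (measurableSet_alive B k))
            (abs_aliveReward_le hC B k)
      _ = _ := by
          rw [integral_indicator_const _ (measurableSet_alive B k), Measure.real,
            pathMeasure_alive, ENNReal.toReal_ofReal (sum_nonneg fun s _ => μ.law_nonneg B k s),
            smul_eq_mul, mul_comm]
  have hsum : Summable fun k => ∫ π, ‖aliveReward M ρ B k π‖ ∂μ.pathMeasure :=
    Summable.of_nonneg_of_le (fun k => integral_nonneg fun π => norm_nonneg _) hnorm
      (h.mul_left C)
  have hint := hasSum_integral_of_summable_integral_norm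
    (fun k => μ.integrable_aliveReward ρ B k) hsum
  simp_rw [integral_aliveReward] at hint
  have hval : ∫ π, f π ∂μ.pathMeasure = ∑ s, μ.occ B s * μ.meanReward ρ s :=
    hint.unique (h.hasSum_dot hD hv _)
  have hmeas : AEStronglyMeasurable f μ.pathMeasure := by
    refine aestronglyMeasurable_of_tendsto_ae Filter.atTop
      (f := fun n π => ∑ k ∈ range n, aliveReward M ρ B k π) (fun n => ?_) ?_
    · exact (Finset.measurable_sum _ fun k _ =>
        measurable_aliveReward ρ B k).aestronglyMeasurable
    · filter_upwards [hae] with π hπ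
      obtain ⟨m, -, -, h2⟩ := exists_hasSum_aliveReward (ρ := ρ) hπ
      exact h2.summable.hasSum.tendsto_sum_nat
  have hfint : Integrable f μ.pathMeasure := by
    refine ⟨hmeas, ?_⟩
    calc ∫⁻ π, ‖f π‖ₑ ∂μ.pathMeasure
        ≤ ∫⁻ π, ∑' k, ENNReal.ofReal ‖aliveReward M ρ B k π‖ ∂μ.pathMeasure := by
          refine lintegral_mono_ae ?_
          filter_upwards [hae] with π hπ
          obtain ⟨m, hm, -, h2⟩ := exists_hasSum_aliveReward (ρ := ρ) hπ
          have h3 : f π = ∑ k ∈ range m, aliveReward M ρ B k π := by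
            refine tsum_eq_sum fun k hk => ?_
            rw [aliveReward, Set.indicator_of_notMem]
            exact fun hc => hk (mem_range.2 ((hm k).1 hc))
          rw [h3, ← ofReal_norm]
          refine le_trans (ENNReal.ofReal_le_ofReal (norm_sum_le _ _)) ?_
          rw [ENNReal.ofReal_sum_of_nonneg fun k _ => norm_nonneg _]
          exact ENNReal.sum_le_tsum _
      _ = ∑' k, ENNReal.ofReal (∫ π, ‖aliveReward M ρ B k π‖ ∂μ.pathMeasure) := by
          rw [lintegral_tsum fun k =>
            ((measurable_aliveReward ρ B k).norm.ennreal_ofReal).aemeasurable]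
          refine tsum_congr fun k => ?_
          rw [ofReal_integral_eq_lintegral_ofReal (μ.integrable_aliveReward ρ B k).norm
            (Filter.Eventually.of_forall fun π => norm_nonneg _)]
      _ < ⊤ := hsum.tsum_ofReal_lt_top
  rw [reachReward, ← hval, integral_eq_lintegral_pos_part_sub_lintegral_neg_part hfint]
  have e1 : ∫⁻ π, (M.pathReward ρ B π).toENNReal ∂μ.pathMeasure
      = ∫⁻ π, ENNReal.ofReal (f π) ∂μ.pathMeasure := by
    refine lintegral_congr_ae ?_
    filter_upwards [hfe] with π hπ
    rw [hπ, EReal.toENNReal_of_ne_top (EReal.coe_ne_top _), EReal.toReal_coe]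
  have e2 : ∫⁻ π, (-M.pathReward ρ B π).toENNReal ∂μ.pathMeasure
      = ∫⁻ π, ENNReal.ofReal (-f π) ∂μ.pathMeasure := by
    refine lintegral_congr_ae ?_
    filter_upwards [hfe] with π hπ
    rw [hπ, ← EReal.coe_neg, EReal.toENNReal_of_ne_top (EReal.coe_ne_top _), EReal.toReal_coe]
  have t1 : ∫⁻ π, ENNReal.ofReal (f π) ∂μ.pathMeasure ≠ ⊤ := hfint.lintegral_lt_top.ne
  have t2 : ∫⁻ π, ENNReal.ofReal (-f π) ∂μ.pathMeasure ≠ ⊤ := hfint.neg.lintegral_lt_top.ne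
  rw [e1, e2, EReal.coe_sub, EReal.coe_ennreal_toReal t1, EReal.coe_ennreal_toReal t2]

/-- If the expected hitting time is infinite, then `B` is missed with positive probability, and the
reachability reward is infinite whatever the reward structure. -/
theorem reachReward_eq_top_of_not_finiteHitting (μ : M.Scheduler) (ρ : S → Act → ℝ)
    {B : Set AP → Prop} (h : ¬ μ.FiniteHitting B) : M.reachReward ρ B μ = ⊤ := by
  obtain ⟨C, hC0, hC⟩ := exists_stepReward_bound (Act := Act) ρ
  have hD := μ.isSubstochastic_killedMatrix B
  have hv := killedInit_nonneg (M := M) B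
  set never := ⋂ k, alive M B k with hnever
  have hmeas : MeasurableSet never := MeasurableSet.iInter fun k => measurableSet_alive B k
  -- The mass on states from which `B` is unreachable bounds the probability of missing `B`.
  have hlow : ∀ k, ENNReal.ofReal (immortalMass (killedInit M B) (μ.killedMatrix B) k)
      ≤ μ.pathMeasure never := by
    intro k
    refine ge_of_tendsto (tendsto_measure_iInter_atTop
      (fun k => (measurableSet_alive B k).nullMeasurableSet) (alive_antitone B)
      ⟨0, measure_ne_top _ _⟩) (Filter.eventually_atTop.2 ⟨k, fun l hl => ?_⟩)
    rw [Function.comp_apply, pathMeasure_alive]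
    refine ENNReal.ofReal_le_ofReal ?_
    obtain ⟨d, rfl⟩ := Nat.exists_eq_add_of_le hl
    refine (immortalMass_le hD hv k d).trans ?_
    rw [law, ← mortalMass_add_immortalMass]
    linarith [mortalMass_nonneg hD hv (k + d)]
  have hpos : μ.pathMeasure never ≠ 0 := by
    obtain ⟨k, hk⟩ := exists_immortalMass_pos hD hv h
    exact ((ENNReal.ofReal_pos.2 hk).trans_le (hlow k)).ne'
  have htop : ∫⁻ π, (M.pathReward ρ B π).toENNReal ∂μ.pathMeasure = ⊤ := by
    refine top_le_iff.1 ?_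
    calc ⊤ = ∫⁻ π, never.indicator (fun _ => ⊤) π ∂μ.pathMeasure := by
          rw [lintegral_indicator_const hmeas, ENNReal.top_mul hpos]
      _ ≤ _ := by
          refine lintegral_mono fun π => ?_
          by_cases hπ : π ∈ never
          · rw [pathReward_of_mem hπ]; simp
          · simp [hπ]
  have hdiff : ∀ k, μ.pathMeasure (alive M B k \ never)
      ≤ ENNReal.ofReal (mortalMass (killedInit M B) (μ.killedMatrix B) k) := by
    intro k
    rw [measure_sdiff (Set.iInter_subset _ k) hmeas.nullMeasurableSet (measure_ne_top _ _),
      pathMeasure_alive, tsub_le_iff_right]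
    refine le_trans ?_ (add_le_add_right (hlow k) _)
    rw [← ENNReal.ofReal_add (mortalMass_nonneg hD hv k) (immortalMass_nonneg hD hv k),
      mortalMass_add_immortalMass]
  have hneg : ∫⁻ π, (-M.pathReward ρ B π).toENNReal ∂μ.pathMeasure ≠ ⊤ := by
    refine ne_top_of_le_ne_top
      (b := ∑' k, ENNReal.ofReal C *
        ENNReal.ofReal (mortalMass (killedInit M B) (μ.killedMatrix B) k)) ?_ ?_
    · rw [ENNReal.tsum_mul_left]
      exact ENNReal.mul_ne_top ENNReal.ofReal_ne_top
        (summable_mortalMass hD hv).tsum_ofReal_ne_top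
    calc ∫⁻ π, (-M.pathReward ρ B π).toENNReal ∂μ.pathMeasure
        ≤ ∫⁻ π, ∑' k, (alive M B k \ never).indicator (fun _ => ENNReal.ofReal C) π
            ∂μ.pathMeasure := by
          refine lintegral_mono fun π => ?_
          by_cases hπ : π ∈ never
          · rw [pathReward_of_mem hπ]; simp
          · obtain ⟨m, hm, h1, -⟩ := exists_hasSum_aliveReward (ρ := ρ) hπ
            rw [h1, ← EReal.coe_neg, EReal.toENNReal_of_ne_top (EReal.coe_ne_top _),
              EReal.toReal_coe, ← sum_neg_distrib]
            refine le_trans ?_ (ENNReal.sum_le_tsum (range m))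
            calc ENNReal.ofReal (∑ k ∈ range m, -stepReward ρ (π k))
                ≤ ENNReal.ofReal (∑ _k ∈ range m, C) :=
                  ENNReal.ofReal_le_ofReal (sum_le_sum fun k _ =>
                    (neg_le_abs _).trans (hC (π k)))
              _ = ∑ _k ∈ range m, ENNReal.ofReal C :=
                  ENNReal.ofReal_sum_of_nonneg fun _ _ => hC0
              _ ≤ _ := by
                  refine sum_le_sum fun k hk => ?_
                  have hk' : π ∈ alive M B k \ never := ⟨(hm k).2 (mem_range.1 hk), hπ⟩
                  rw [Set.indicator_of_mem hk']
      _ = ∑' k, ENNReal.ofReal C * μ.pathMeasure (alive M B k \ never) := by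
          rw [lintegral_tsum fun k => (measurable_const.indicator
            ((measurableSet_alive B k).diff hmeas)).aemeasurable]
          exact tsum_congr fun k =>
            lintegral_indicator_const ((measurableSet_alive B k).diff hmeas) _
      _ ≤ _ := ENNReal.tsum_le_tsum fun k => by gcongr; exact hdiff k
  rw [reachReward, htop]
  lift (∫⁻ π, (-M.pathReward ρ B π).toENNReal ∂μ.pathMeasure) to ℝ≥0 using hneg with x
  exact EReal.top_sub_coe x

end MDP.Scheduler

lemma MDP.RewardFinite.finiteHitting {S Act AP : Type*} [Fintype S] [Fintype Act]
    {M : MDP S Act AP} {ρ : S → Act → ℝ} {B : Set AP → Prop} (h : M.RewardFinite ρ B)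
    (μ : M.Scheduler) : μ.FiniteHitting B := by
  by_contra hc
  have h1 := μ.reachReward_eq_top_of_not_finiteHitting ρ hc
  exact (lt_of_le_of_lt (le_iSup (fun μ => M.reachReward ρ B μ) μ) h).ne h1

end

noncomputable section

open Finset

/-! ### One-step expectations -/

namespace MDP

variable {S Act AP : Type*} [Fintype S]

/-- The mean of a function of the successor state under a given action. -/
def nextMean (M : MDP S Act AP) (s : S) (o : Option Act) (V : S → ℝ) : ℝ :=
  ∑ t, (M.next s o t).toReal * V t

open Classical in
/-- The function `V`, set to zero on the states that satisfy `B`. -/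
def killFn (M : MDP S Act AP) (B : Set AP → Prop) (V : S → ℝ) (t : S) : ℝ :=
  if B (M.L t) then 0 else V t

lemma killFn_of_not {M : MDP S Act AP} {B : Set AP → Prop} {V : S → ℝ} {t : S}
    (h : ¬ B (M.L t)) : M.killFn B V t = V t := if_neg h

lemma killFn_of {M : MDP S Act AP} {B : Set AP → Prop} {V : S → ℝ} {t : S}
    (h : B (M.L t)) : M.killFn B V t = 0 := if_pos h

lemma killFn_le {M : MDP S Act AP} {B : Set AP → Prop} {V : S → ℝ} {t : S} (h : 0 ≤ V t) :
    M.killFn B V t ≤ V t := by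
  rw [killFn]; split_ifs <;> simp [h]

lemma nextMean_eq_of_next_eq_pure {M : MDP S Act AP} {s : S} {o : Option Act} {t : S}
    (h : M.next s o = PMF.pure t) (V : S → ℝ) : M.nextMean s o V = V t := by
  classical
  rw [nextMean, h, sum_eq_single t]
  · simp
  · intro u _ hu; simp [PMF.pure_apply, hu]
  · simp

lemma nextMean_some {M : MDP S Act AP} {s : S} {a : Act} (h : a ∈ M.enabled s) (V : S → ℝ) :
    M.nextMean s (some a) V = ∑ t, (M.P s a t : ℝ) * V t := by
  have h' : ∑ t, M.P s a t = 1 := h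
  rw [nextMean]
  refine sum_congr rfl fun t _ => ?_
  rw [next, dif_pos h', PMF.ofFintype_apply]
  rfl

lemma next_of_not_enabled {M : MDP S Act AP} {s : S} {a : Act} (h : a ∉ M.enabled s) :
    M.next s (some a) = PMF.pure s := dif_neg h

/-- A scheduler that picks an arbitrary enabled action. -/
def defaultScheduler (M : MDP S Act AP) : M.Scheduler := by
  classical
  exact
  { choice := fun s => if h : (M.enabled s).Nonempty then PMF.pure (some h.some) else PMF.pure none
    enabled_of_mem := fun s a ha => by
      split_ifs at ha with h
      · simp only [PMF.support_pure, Set.mem_singleton_iff, Option.some.injEq] at ha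
        exact ha ▸ h.some_mem
      · simp at ha
    blocked_of_mem := fun s ha => by
      split_ifs at ha with h
      · simp at ha
      · exact Set.not_nonempty_iff_eq_empty.1 h }

namespace Scheduler

variable {M : MDP S Act AP}

lemma sum_killedInit_mul (M : MDP S Act AP) (B : Set AP → Prop) (V : S → ℝ) :
    ∑ s, killedInit M B s * V s = M.killFn B V M.init := by
  classical
  rw [sum_eq_single M.init]
  · simp [killedInit, killFn]
  · intro s _ hs; simp [killedInit, hs]
  · simp

/-- State-dependent mixtures of schedulers exist. -/
lemma exists_mixture {ι : Type*} [Fintype ι] [Nonempty ι] (μ : ι → M.Scheduler)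
    (y : ι → S → ℝ) (hy : ∀ u s, 0 ≤ y u s) :
    ∃ ν : M.Scheduler, ∀ s o, (∑ u, y u s) * (ν.choice s o).toReal
      = ∑ u, y u s * ((μ u).choice s o).toReal := by
  classical
  have hw : ∀ s, ∃ w : PMF ι, ∀ u, (∑ u, y u s) * (w u).toReal = y u s := by
    intro s
    rcases (sum_nonneg fun u (_ : u ∈ univ) => hy u s).eq_or_lt with h | h
    · refine ⟨PMF.pure (Classical.arbitrary ι), fun u => ?_⟩
      rw [← h, zero_mul, (sum_eq_zero_iff_of_nonneg fun u _ => hy u s).1 h.symm u (mem_univ u)]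
    · have hsum : ∑ u, ENNReal.ofReal (y u s / ∑ u, y u s) = 1 := by
        rw [← ENNReal.ofReal_sum_of_nonneg fun u _ => div_nonneg (hy u s) h.le, ← sum_div,
          div_self h.ne', ENNReal.ofReal_one]
      refine ⟨PMF.ofFintype _ hsum, fun u => ?_⟩
      rw [PMF.ofFintype_apply, ENNReal.toReal_ofReal (div_nonneg (hy u s) h.le)]
      field_simp
  choose w hw using hw
  refine ⟨⟨fun s => (w s).bind fun u => (μ u).choice s, fun s a ha => ?_, fun s ha => ?_⟩,
    fun s o => ?_⟩
  · obtain ⟨u, -, hu⟩ := (PMF.mem_support_bind_iff _ _ _).1 ha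
    exact (μ u).enabled_of_mem s a hu
  · obtain ⟨u, -, hu⟩ := (PMF.mem_support_bind_iff _ _ _).1 ha
    exact (μ u).blocked_of_mem s hu
  · change _ * ((w s).bind (fun u => (μ u).choice s) o).toReal = _
    rw [PMF.bind_apply, tsum_fintype, ENNReal.toReal_sum fun u _ =>
      ENNReal.mul_ne_top (PMF.apply_ne_top _ _) (PMF.apply_ne_top _ _), mul_sum]
    refine sum_congr rfl fun u _ => ?_
    rw [ENNReal.toReal_mul, ← mul_assoc, hw]

variable [Fintype Act]

lemma actMean_congr {μ : M.Scheduler} {s : S} {f g : Option Act → ℝ}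
    (h : ∀ o, o ∈ (μ.choice s).support → f o = g o) : μ.actMean s f = μ.actMean s g := by
  refine sum_congr rfl fun o _ => ?_
  by_cases ho : o ∈ (μ.choice s).support
  · rw [h o ho]
  · rw [(PMF.apply_eq_zero_iff _ _).2 ho]; simp

/-- The mean of a function of the next state. -/
def transMean (μ : M.Scheduler) (s : S) (V : S → ℝ) : ℝ :=
  μ.actMean s fun o => M.nextMean s o V

lemma transMean_eq_sum (μ : M.Scheduler) (s : S) (V : S → ℝ) :
    μ.transMean s V = ∑ t, (μ.trans s t).toReal * V t := by
  have h : ∀ t, (μ.trans s t).toReal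
      = ∑ o, (μ.choice s o).toReal * (M.next s o t).toReal := by
    intro t
    rw [trans, PMF.bind_apply, tsum_fintype, ENNReal.toReal_sum fun o _ =>
      ENNReal.mul_ne_top (PMF.apply_ne_top _ _) (PMF.apply_ne_top _ _)]
    simp_rw [ENNReal.toReal_mul]
  simp_rw [h, sum_mul, transMean, actMean, nextMean, mul_sum, mul_assoc]
  exact sum_comm

lemma mulVec_killedMatrix (μ : M.Scheduler) (B : Set AP → Prop) (V : S → ℝ) (s : S) :
    (μ.killedMatrix B).mulVec V s = μ.transMean s (M.killFn B V) := by
  rw [transMean_eq_sum]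
  simp only [Matrix.mulVec, dotProduct]
  refine sum_congr rfl fun t _ => ?_
  rw [killedMatrix, killFn]; split_ifs <;> simp

lemma killedMatrix_apply [DecidableEq S] (μ : M.Scheduler) (B : Set AP → Prop) (s t : S) :
    μ.killedMatrix B s t = μ.transMean s (M.killFn B (Pi.single t 1)) := by
  rw [← mulVec_killedMatrix, Matrix.mulVec_single_one]; rfl

lemma transMean_mono (μ : M.Scheduler) (s : S) {V W : S → ℝ} (h : ∀ t, V t ≤ W t) :
    μ.transMean s V ≤ μ.transMean s W := by
  rw [transMean_eq_sum, transMean_eq_sum]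
  exact sum_le_sum fun t _ => mul_le_mul_of_nonneg_left (h t) ENNReal.toReal_nonneg

lemma transMean_add (μ : M.Scheduler) (s : S) (V W : S → ℝ) :
    μ.transMean s (fun t => V t + W t) = μ.transMean s V + μ.transMean s W := by
  simp_rw [transMean_eq_sum, mul_add, sum_add_distrib]

lemma transMean_const (μ : M.Scheduler) (s : S) (c : ℝ) : μ.transMean s (fun _ => c) = c := by
  rw [transMean_eq_sum, ← sum_mul, sum_toReal_pmf, one_mul]

open Classical in
/-- A set of states is left with probability zero if the mean of the indicator function of its
complement after one step is nonpositive. -/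
lemma mem_of_transMean_nonpos (μ : M.Scheduler) (B : Set AP → Prop) {R : S → Prop} {s t : S}
    (h : μ.transMean s (M.killFn B fun u => if R u then 0 else 1) ≤ 0)
    (hst : 0 < μ.killedMatrix B s t) : R t := by
  by_contra ht
  rw [← mulVec_killedMatrix] at h
  have h1 : μ.killedMatrix B s t * (if R t then 0 else 1) ≤
      (μ.killedMatrix B).mulVec (fun u => if R u then 0 else 1) s :=
    single_le_sum (f := fun u => μ.killedMatrix B s u * (if R u then (0 : ℝ) else 1)) (fun u _ =>
      mul_nonneg ((μ.isSubstochastic_killedMatrix _).nonneg s u) (by split_ifs <;> simp))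
      (mem_univ t)
  rw [if_neg ht] at h1
  linarith

/-- The expected reward before `B` is reached, as a real number. -/
def value (μ : M.Scheduler) (B : Set AP → Prop) (ρ : S → Act → ℝ) : ℝ :=
  ∑ s, μ.occ B s * μ.meanReward ρ s

lemma reachReward_eq_value (μ : M.Scheduler) (ρ : S → Act → ℝ) {B : Set AP → Prop}
    (h : μ.FiniteHitting B) : M.reachReward ρ B μ = (μ.value B ρ : EReal) :=
  μ.reachReward_eq_of_finiteHitting ρ h

lemma value_eq_potential (μ : M.Scheduler) (ρ : S → Act → ℝ) {B : Set AP → Prop}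
    (h : μ.FiniteHitting B) :
    μ.value B ρ = M.killFn B (potential (μ.killedMatrix B) (μ.meanReward ρ)) M.init := by
  rw [value, h.sum_occupation_mul (μ.isSubstochastic_killedMatrix B) (killedInit_nonneg B),
    sum_killedInit_mul]

/-! ### Mixtures of memoryless schedulers -/

/-- Finite weighted sums of the rewards of memoryless schedulers are realised, for all reward
structures simultaneously, by one memoryless scheduler: in every state it mixes the schedulers in
proportion to their weighted numbers of visits, so that the weighted sum of the occupation vectors
satisfies its balance equation. -/
theorem exists_value_eq_sum {ι : Type*} [Fintype ι] [Nonempty ι] {B : Set AP → Prop}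
    (hfin : ∀ μ : M.Scheduler, μ.FiniteHitting B) (μ : ι → M.Scheduler) (w : ι → ℝ)
    (hw : ∀ u, 0 ≤ w u) :
    ∃ ν : M.Scheduler, ∀ ρ, (∑ u, w u) * ν.value B ρ = ∑ u, w u * (μ u).value B ρ := by
  classical
  have hD := fun μ : M.Scheduler => μ.isSubstochastic_killedMatrix B
  have hv := killedInit_nonneg (M := M) B
  have hocc := fun (μ : M.Scheduler) s => occupation_nonneg (hD μ) hv s
  have hy : ∀ u s, 0 ≤ w u * (μ u).occ B s := fun u s => mul_nonneg (hw u) (hocc _ s)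
  obtain ⟨ν, hν⟩ := exists_mixture μ (fun u s => w u * (μ u).occ B s) hy
  have hact : ∀ s f, (∑ u, w u * (μ u).occ B s) * ν.actMean s f
      = ∑ u, w u * (μ u).occ B s * (μ u).actMean s f := by
    intro s f
    simp_rw [actMean, mul_sum]
    rw [sum_comm]
    refine sum_congr rfl fun o _ => ?_
    rw [← mul_assoc, hν, sum_mul]
    exact sum_congr rfl fun u _ => by ring
  have hmat : ∀ s t, (∑ u, w u * (μ u).occ B s) * ν.killedMatrix B s t
      = ∑ u, w u * (μ u).occ B s * (μ u).killedMatrix B s t := by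
    intro s t
    simp_rw [killedMatrix_apply, transMean]
    exact hact s _
  have hbal : ∀ t, ∑ u, w u * (μ u).occ B t = (∑ u, w u) * killedInit M B t
      + ∑ s, (∑ u, w u * (μ u).occ B s) * ν.killedMatrix B s t := by
    intro t
    simp_rw [hmat]
    rw [sum_comm, sum_mul, ← sum_add_distrib]
    refine sum_congr rfl fun u _ => ?_
    rw [occ, (hfin (μ u)).occupation_eq (hD _) hv t, mul_add, mul_sum]
    simp_rw [mul_assoc]
  have hsupp : ∀ s, 0 < ∑ u, w u * (μ u).occ B s → 0 < ν.occ B s := by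
    intro s hs
    obtain ⟨u, -, hu⟩ := exists_lt_of_sum_lt (s := univ) (f := fun _ : ι => (0 : ℝ))
      (by simpa using hs)
    have hwu : 0 < w u := (hw u).lt_of_ne' fun h => by simp [h] at hu
    refine (mem_of_occupation_pos (R := fun s => 0 < ν.occ B s ∧ 0 < (μ u).occ B s) (hD (μ u)) hv
      (fun s hs => ⟨(hfin ν).occupation_pos_of_pos (hD ν) hv hs,
        (hfin (μ u)).occupation_pos_of_pos (hD (μ u)) hv hs⟩) (fun s t hs hst => ?_)
      (pos_of_mul_pos_right hu hwu.le)).1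
    refine ⟨(hfin ν).occupation_pos_step (hD ν) hv hs.1 ?_,
      (hfin (μ u)).occupation_pos_step (hD (μ u)) hv hs.2 hst⟩
    refine ((hD ν).nonneg s t).lt_of_ne' fun h0 => ?_
    have h1 := hmat s t
    rw [h0, mul_zero] at h1
    have h2 := (sum_eq_zero_iff_of_nonneg fun u _ =>
      mul_nonneg (hy u s) ((hD (μ u)).nonneg s t)).1 h1.symm u (mem_univ u)
    exact (mul_pos (mul_pos hwu hs.2) hst).ne' h2
  have key := (hfin ν).eq_mul_occupation (hD ν) hv (fun s => sum_nonneg fun u _ => hy u s)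
    hbal hsupp
  refine ⟨ν, fun ρ => ?_⟩
  simp_rw [value, mul_sum, ← mul_assoc]
  rw [sum_comm (s := univ) (t := univ) (f := fun u s => w u * (μ u).occ B s * (μ u).meanReward ρ s)]
  refine sum_congr rfl fun s _ => ?_
  rw [← key s]
  exact hact s _

end Scheduler

end MDP

end

noncomputable section

open Finset MDP MDP.Scheduler

/-! ### Actions and transitions of the centralised MDP -/

instance : Fintype Ctrl :=
  have : Finite Ctrl := Finite.of_surjective
    (fun k : Fin 3 => if k = 0 then Ctrl.assign else if k = 1 then Ctrl.forward else Ctrl.nextTask)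
    (by rintro (_ | _ | _); exacts [⟨0, by simp⟩, ⟨1, by simp⟩, ⟨2, by simp⟩])
  Fintype.ofFinite _

lemma taskDone_agentTask_iff {S Q Act AP : Type*} [Fintype S] [Fintype Q] {M : MDP S Act AP}
    {T : DFA (Set AP) Q} {z : S × Q} : TaskDone ((agentTask M T).L z) ↔ T.Ended z.2 := by
  simp [TaskDone, agentTask]

section Centralised

variable {n : ℕ} [NeZero n] {S Q : Fin n → Type*} {Act AP : Type*}
  [∀ i, Fintype (S i)] [∀ j, Fintype (Q j)]
  {M : ∀ i, MDP (S i) Act AP} {T : ∀ j, DFA (Set AP) (Q j)}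

lemma ctDone_iff {x : CtState S Q} :
    CtDone ((ctMDP M T).L x) ↔ (x.1.2 : ℕ) + 1 = n ∧ (T x.1.2).Ended x.2.2.1 := by
  simp [CtDone, ctMDP]

lemma ct_enabled_inr {x : CtState S Q} {b : Ctrl} :
    Sum.inr b ∈ (ctMDP M T).enabled x ↔ ∃ y, ctrlNext M T b x = some y := by
  classical
  change ∑ y, (if ctrlNext M T b x = some y then (1 : ℝ≥0) else 0) = 1 ↔ _
  cases h : ctrlNext M T b x with
  | none => simp
  | some z => simp

lemma ct_next_inr {x y : CtState S Q} {b : Ctrl} (h : ctrlNext M T b x = some y) :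
    (ctMDP M T).next x (some (Sum.inr b)) = PMF.pure y := by
  classical
  have h1 : ∑ y, (ctMDP M T).P x (Sum.inr b) y = 1 := ct_enabled_inr.2 ⟨y, h⟩
  rw [next, dif_pos h1]
  ext z
  rw [PMF.ofFintype_apply, PMF.pure_apply]
  change ((if ctrlNext M T b x = some z then (1 : ℝ≥0) else 0 : ℝ≥0) : ℝ≥0∞) = _
  rw [h]
  simp only [Option.some.injEq, eq_comm (a := y)]
  split_ifs <;> simp

/-- The agent's actions are available: the current agent is assigned and the model does not have to
move on to the next task. -/
def AgentActive (T : ∀ j, DFA (Set AP) (Q j)) (x : CtState S Q) : Prop :=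
  x.1.1 ∈ x.2.2.2 ∧ ¬ ((T x.1.2).Ended x.2.2.1 ∧ (x.1.2 : ℕ) + 1 < n)

lemma sum_ctP_inl {R : Type*} [CommSemiring R] (f : ℝ≥0 →+* R) {i j : Fin n} {s : S i} {q : Q j}
    {U : Finset (Fin n)} (hx : AgentActive (S := S) T ⟨(i, j), s, q, U⟩) (a : Act)
    (V : CtState S Q → R) :
    ∑ y, f ((ctMDP M T).P ⟨(i, j), s, q, U⟩ (Sum.inl a) y) * V y
      = ∑ z, f ((agentTask (M i) (T j)).P (s, q) a z) * V ⟨(i, j), z.1, z.2, U⟩ := by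
  classical
  have h : ∀ y, (ctMDP M T).P ⟨(i, j), s, q, U⟩ (Sum.inl a) y = ∑ z : S i × Q j,
      if y = ⟨(i, j), z.1, z.2, U⟩ then (agentTask (M i) (T j)).P (s, q) a z else 0 := by
    intro y
    change ctP M T ⟨(i, j), s, q, U⟩ (Sum.inl a) y = _
    simp only [ctP]
    rw [if_pos (show i ∈ U ∧ ¬ ((T j).Ended q ∧ (j : ℕ) + 1 < n) from hx)]
  simp_rw [h, map_sum, sum_mul]
  rw [sum_comm]
  refine sum_congr rfl fun z _ => ?_
  rw [sum_eq_single (⟨(i, j), z.1, z.2, U⟩ : CtState S Q)]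
  · simp
  · intro y _ hy; simp [hy]
  · simp

lemma ct_enabled_inl {i j : Fin n} {s : S i} {q : Q j} {U : Finset (Fin n)} {a : Act} :
    Sum.inl a ∈ (ctMDP M T).enabled ⟨(i, j), s, q, U⟩ ↔
      AgentActive (S := S) T ⟨(i, j), s, q, U⟩ ∧ a ∈ (agentTask (M i) (T j)).enabled (s, q) := by
  classical
  by_cases hx : AgentActive (S := S) T ⟨(i, j), s, q, U⟩
  · have := sum_ctP_inl (M := M) (RingHom.id ℝ≥0) hx a fun _ => 1
    simp only [RingHom.id_apply, mul_one] at this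
    simp only [hx, true_and, enabled, Set.mem_ofPred_eq, this]
  · have : ∀ y, (ctMDP M T).P ⟨(i, j), s, q, U⟩ (Sum.inl a) y = 0 := by
      intro y
      change ctP M T ⟨(i, j), s, q, U⟩ (Sum.inl a) y = _
      simp only [ctP]
      exact if_neg hx
    simp [enabled, this, hx]

lemma ct_nextMean_map_inl {i j : Fin n} {s : S i} {q : Q j} {U : Finset (Fin n)}
    (hx : AgentActive (S := S) T ⟨(i, j), s, q, U⟩) (o : Option Act) (V : CtState S Q → ℝ) :
    (ctMDP M T).nextMean ⟨(i, j), s, q, U⟩ (o.map Sum.inl) V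
      = (agentTask (M i) (T j)).nextMean (s, q) o fun z => V ⟨(i, j), z.1, z.2, U⟩ := by
  cases o with
  | none => rw [Option.map_none, nextMean_eq_of_next_eq_pure rfl, nextMean_eq_of_next_eq_pure rfl]
  | some a =>
    rw [Option.map_some]
    by_cases ha : a ∈ (agentTask (M i) (T j)).enabled (s, q)
    · rw [nextMean_some ha, nextMean_some (ct_enabled_inl.2 ⟨hx, ha⟩)]
      exact sum_ctP_inl NNReal.toRealHom hx a V
    · rw [nextMean_eq_of_next_eq_pure (next_of_not_enabled ha),
        nextMean_eq_of_next_eq_pure (next_of_not_enabled fun h => ha (ct_enabled_inl.1 h).2)]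

/-- The agent part of an action of the centralised MDP. -/
def agentPart : Option (Act ⊕ Ctrl) → Option Act
  | some (Sum.inl a) => some a
  | _ => none

open Classical in
/-- The scheduler of the agent-task MDP of agent `i` and task `j` that a scheduler of the
centralised MDP induces when the set of assigned agents is `U`.  Where the centralised scheduler
says nothing about the agent, the scheduler `β` is followed. -/
def agentScheduler (μ : (ctMDP M T).Scheduler) (i j : Fin n) (β : (agentTask (M i) (T j)).Scheduler)
    (U : Finset (Fin n)) : (agentTask (M i) (T j)).Scheduler where
  choice z := if i ∈ U ∧ ¬ (T j).Ended z.2 then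
    (μ.choice ⟨(i, j), z.1, z.2, U⟩).map agentPart else β.choice z
  enabled_of_mem z a ha := by
    split_ifs at ha with h
    · obtain ⟨o, ho, hoa⟩ := (PMF.mem_support_map_iff _ _ _).1 ha
      obtain _ | a' | b := o
      · simp [agentPart] at hoa
      · simp only [agentPart, Option.some.injEq] at hoa
        exact hoa ▸ (ct_enabled_inl.1 (μ.enabled_of_mem _ _ ho)).2
      · simp [agentPart] at hoa
    · exact β.enabled_of_mem z a ha
  blocked_of_mem z ha := by
    split_ifs at ha with h
    · have hx : AgentActive (S := S) T ⟨(i, j), z.1, z.2, U⟩ := ⟨h.1, fun hc => h.2 hc.1⟩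
      obtain ⟨o, ho, hoa⟩ := (PMF.mem_support_map_iff _ _ _).1 ha
      obtain _ | a' | b := o
      · have h1 := μ.blocked_of_mem _ ho
        refine Set.eq_empty_of_forall_notMem fun a ha => ?_
        have h2 : Sum.inl a ∈ (ctMDP M T).enabled ⟨(i, j), z.1, z.2, U⟩ :=
          ct_enabled_inl.2 ⟨hx, ha⟩
        rw [h1] at h2
        exact h2
      · simp [agentPart] at hoa
      · obtain ⟨y, hy⟩ := ct_enabled_inr.1 (μ.enabled_of_mem _ _ ho)
        cases b <;> simp [ctrlNext, h.1, h.2] at hy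
    · exact β.blocked_of_mem z ha

lemma sum_map_toReal {α β : Type*} [Fintype α] [Fintype β] (p : PMF α) (g : α → β) (f : β → ℝ) :
    ∑ b, (p.map g b).toReal * f b = ∑ a, (p a).toReal * f (g a) := by
  classical
  have h : ∀ b, (p.map g b).toReal = ∑ a, if b = g a then (p a).toReal else 0 := by
    intro b
    rw [PMF.map_apply, tsum_fintype, ENNReal.toReal_sum fun a _ => by
      split_ifs; exacts [PMF.apply_ne_top _ _, ENNReal.zero_ne_top]]
    refine sum_congr rfl fun a _ => ?_
    split_ifs <;> simp
  simp_rw [h, sum_mul]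
  rw [sum_comm]
  refine sum_congr rfl fun a _ => ?_
  simp

section ActMean

variable (μ : (ctMDP M T).Scheduler) {i j : Fin n} {s : S i} {q : Q j} {U : Finset (Fin n)}

/-- The probability that the current agent is assigned the current task. -/
def assignProb (i j : Fin n) (U : Finset (Fin n)) : ℝ :=
  (μ.choice ⟨(i, j), (M i).init, (T j).start, U⟩ (some (Sum.inr Ctrl.assign))).toReal

lemma assignProb_nonneg : 0 ≤ assignProb μ i j U := ENNReal.toReal_nonneg

lemma assignProb_of_mem (hi : i ∈ U) : assignProb μ i j U = 0 := by
  rw [assignProb, ENNReal.toReal_eq_zero_iff, PMF.apply_eq_zero_iff]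
  left
  intro ho
  obtain ⟨y, hy⟩ := ct_enabled_inr.1 (μ.enabled_of_mem _ _ ho)
  simp [ctrlNext, hi] at hy

lemma assignProb_le_one : assignProb μ i j U ≤ 1 :=
  ENNReal.toReal_le_of_le_ofReal zero_le_one (by simpa using PMF.coe_le_one _ _)

variable [Fintype Act]

lemma actMean_active (β : (agentTask (M i) (T j)).Scheduler) (hi : i ∈ U) (hq : ¬ (T j).Ended q)
    (f : Option (Act ⊕ Ctrl) → ℝ) :
    μ.actMean ⟨(i, j), s, q, U⟩ f
      = (agentScheduler μ i j β U).actMean (s, q) fun o => f (o.map Sum.inl) := by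
  have e : (agentScheduler μ i j β U).choice (s, q) = (μ.choice ⟨(i, j), s, q, U⟩).map agentPart :=
    if_pos ⟨hi, hq⟩
  rw [actMean, actMean, e, sum_map_toReal]
  refine actMean_congr fun o ho => ?_
  obtain _ | a' | b := o
  · rfl
  · rfl
  · obtain ⟨y, hy⟩ := ct_enabled_inr.1 (μ.enabled_of_mem _ _ ho)
    cases b <;> simp [ctrlNext, hi, hq] at hy

lemma transMean_active (β : (agentTask (M i) (T j)).Scheduler) (hi : i ∈ U)
    (hq : ¬ (T j).Ended q) (V : CtState S Q → ℝ) :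
    μ.transMean ⟨(i, j), s, q, U⟩ V
      = (agentScheduler μ i j β U).transMean (s, q) fun z => V ⟨(i, j), z.1, z.2, U⟩ := by
  rw [transMean, actMean_active μ β hi hq, transMean]
  congr 1
  funext o
  exact ct_nextMean_map_inl ⟨hi, fun h => hq h.1⟩ o V

lemma actMean_ended (hi : i ∈ U) (hq : (T j).Ended q)
    (h : (univ.filter fun k : Fin n => k ∉ U).Nonempty ∧ (j : ℕ) + 1 < n)
    (f : Option (Act ⊕ Ctrl) → ℝ) :
    μ.actMean ⟨(i, j), s, q, U⟩ f = f (some (Sum.inr Ctrl.nextTask)) := by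
  rw [actMean_congr (g := fun _ => f (some (Sum.inr Ctrl.nextTask)))]
  · rw [actMean, ← sum_mul, sum_toReal_pmf, one_mul]
  · intro o ho
    obtain _ | a' | b := o
    · have h1 := μ.blocked_of_mem _ ho
      have h2 : Sum.inr Ctrl.nextTask ∈ (ctMDP M T).enabled ⟨(i, j), s, q, U⟩ :=
        ct_enabled_inr.2 (by simp [ctrlNext, hi, hq, h])
      rw [h1] at h2
      exact h2.elim
    · have := (ct_enabled_inl.1 (μ.enabled_of_mem _ _ ho)).1.2
      exact (this ⟨hq, h.2⟩).elim
    · obtain ⟨y, hy⟩ := ct_enabled_inr.1 (μ.enabled_of_mem _ _ ho)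
      cases b
      · simp [ctrlNext, hi] at hy
      · simp [ctrlNext, hi] at hy
      · rfl

lemma transMean_ended (hi : i ∈ U) (hq : (T j).Ended q)
    (h : (univ.filter fun k : Fin n => k ∉ U).Nonempty ∧ (j : ℕ) + 1 < n)
    (V : CtState S Q → ℝ) :
    μ.transMean ⟨(i, j), s, q, U⟩ V
      = V ⟨(min' _ h.1, ⟨j + 1, h.2⟩), (M _).init, (T _).start, U⟩ := by
  rw [transMean, actMean_ended μ hi hq h]
  exact nextMean_eq_of_next_eq_pure (ct_next_inr (by simp [ctrlNext, hi, hq, h])) V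

lemma actMean_unassigned (hi : i ∉ U) (f : Option (Act ⊕ Ctrl) → ℝ) :
    μ.actMean ⟨(i, j), (M i).init, (T j).start, U⟩ f
      = assignProb μ i j U * f (some (Sum.inr Ctrl.assign))
        + (1 - assignProb μ i j U) * f (some (Sum.inr Ctrl.forward)) := by
  classical
  have h0 : ∀ o, o ∈ (μ.choice ⟨(i, j), (M i).init, (T j).start, U⟩).support →
      o = some (Sum.inr Ctrl.assign) ∨ o = some (Sum.inr Ctrl.forward) := by
    intro o ho
    obtain _ | a' | b := o
    · have h1 := μ.blocked_of_mem _ ho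
      have h2 : Sum.inr Ctrl.assign ∈
          (ctMDP M T).enabled ⟨(i, j), (M i).init, (T j).start, U⟩ :=
        ct_enabled_inr.2 (by simp [ctrlNext, hi])
      rw [h1] at h2
      exact h2.elim
    · exact (hi (ct_enabled_inl.1 (μ.enabled_of_mem _ _ ho)).1.1).elim
    · obtain ⟨y, hy⟩ := ct_enabled_inr.1 (μ.enabled_of_mem _ _ ho)
      cases b
      · simp
      · simp
      · simp [ctrlNext, hi] at hy
  have h1 : ∀ f : Option (Act ⊕ Ctrl) → ℝ,
      μ.actMean ⟨(i, j), (M i).init, (T j).start, U⟩ f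
        = assignProb μ i j U * f (some (Sum.inr Ctrl.assign))
          + (μ.choice ⟨(i, j), (M i).init, (T j).start, U⟩ (some (Sum.inr Ctrl.forward))).toReal
            * f (some (Sum.inr Ctrl.forward)) := by
    intro f
    have hne : (some (Sum.inr Ctrl.assign) : Option (Act ⊕ Ctrl))
        ≠ some (Sum.inr Ctrl.forward) := by simp
    rw [actMean,
      ← sum_subset (subset_univ {some (Sum.inr Ctrl.assign), some (Sum.inr Ctrl.forward)}),
      sum_pair hne, assignProb]
    intro o _ ho
    have : o ∉ (μ.choice ⟨(i, j), (M i).init, (T j).start, U⟩).support := fun hc => by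
      rcases h0 o hc with rfl | rfl <;> simp at ho
    rw [(PMF.apply_eq_zero_iff _ _).2 this]; simp
  have h2 := h1 fun _ => 1
  rw [actMean, ← sum_mul, sum_toReal_pmf] at h2
  rw [h1, ← eq_sub_iff_add_eq'.2 (by linarith : assignProb μ i j U + _ = (1 : ℝ))]

lemma assignProb_eq_one (hi : i ∉ U)
    (h : ¬ (univ.filter fun k : Fin n => i < k ∧ k ∉ U).Nonempty) : assignProb μ i j U = 1 := by
  classical
  have h1 := actMean_unassigned μ (j := j) hi fun o =>
    if o = some (Sum.inr Ctrl.forward) then 1 else 0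
  rw [actMean_congr (g := fun _ => 0)] at h1
  · simp [actMean] at h1; linarith
  · intro o ho
    rw [if_neg]
    rintro rfl
    obtain ⟨y, hy⟩ := ct_enabled_inr.1 (μ.enabled_of_mem _ _ ho)
    simp [ctrlNext, hi, h] at hy

open Classical in
/-- The value of a function at the state reached by forwarding the task; zero if that is
impossible. -/
def forwardValue (M : ∀ i, MDP (S i) Act AP) (T : ∀ j, DFA (Set AP) (Q j)) (i j : Fin n)
    (U : Finset (Fin n)) (V : CtState S Q → ℝ) : ℝ :=
  if h : (univ.filter fun k : Fin n => i < k ∧ k ∉ U).Nonempty then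
    V ⟨(min' _ h, j), (M _).init, (T j).start, U⟩ else 0

lemma transMean_unassigned (hi : i ∉ U) (V : CtState S Q → ℝ) :
    μ.transMean ⟨(i, j), (M i).init, (T j).start, U⟩ V
      = assignProb μ i j U * V ⟨(i, j), (M i).init, (T j).start, insert i U⟩
        + (1 - assignProb μ i j U) * forwardValue M T i j U V := by
  classical
  have h1 : (ctMDP M T).nextMean ⟨(i, j), (M i).init, (T j).start, U⟩
      (some (Sum.inr Ctrl.assign)) V = V ⟨(i, j), (M i).init, (T j).start, insert i U⟩ := by
    refine nextMean_eq_of_next_eq_pure (ct_next_inr ?_) V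
    simp only [ctrlNext, hi, not_false_eq_true, and_self, if_true]
  rw [transMean, actMean_unassigned μ hi, h1, forwardValue]
  split_ifs with h
  · rw [nextMean_eq_of_next_eq_pure (t := ⟨(min' _ h, j), (M _).init, (T j).start, U⟩)
      (ct_next_inr (by simp [ctrlNext, hi, h])) V]
  · rw [assignProb_eq_one μ hi h]; simp

end ActMean

end Centralised

end

noncomputable section

open Finset MDP MDP.Scheduler

/-! ### Analysis of a scheduler of the centralised MDP -/

section CentralisedScheduler

lemma killFn_eq_zero {S Act AP : Type*} [Fintype S] {M : MDP S Act AP} {B : Set AP → Prop}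
    {V : S → ℝ} {t : S} (h : ¬ B (M.L t) → V t = 0) : M.killFn B V t = 0 := by
  rw [killFn]; split_ifs with hB; exacts [rfl, h hB]

lemma killFn_eq_self {S Act AP : Type*} [Fintype S] {M : MDP S Act AP} {B : Set AP → Prop}
    {V : S → ℝ} {t : S} (h : B (M.L t) → V t = 0) : M.killFn B V t = V t := by
  rw [killFn]; split_ifs with hB; exacts [(h hB).symm, rfl]

lemma nonempty_unassigned {n : ℕ} {U : Finset (Fin n)} (h : #U < n) :
    (univ.filter fun k : Fin n => k ∉ U).Nonempty := by
  by_contra hc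
  rw [not_nonempty_iff_eq_empty, filter_eq_empty_iff] at hc
  have : U = univ := eq_univ_of_forall fun k => not_not.1 (hc (mem_univ k))
  simp [this] at h

lemma min'_unassigned_notMem {n : ℕ} {U : Finset (Fin n)}
    (h : (univ.filter fun k : Fin n => k ∉ U).Nonempty) : min' _ h ∉ U :=
  (mem_filter.1 (min'_mem _ h)).2

lemma min'_forward {n : ℕ} {i : Fin n} {U : Finset (Fin n)}
    (h : (univ.filter fun k : Fin n => i < k ∧ k ∉ U).Nonempty) : i < min' _ h ∧ min' _ h ∉ U :=
  (mem_filter.1 (min'_mem _ h)).2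

variable {n : ℕ} [NeZero n] {S Q : Fin n → Type*} {Act AP : Type*}
  [∀ i, Fintype (S i)] [∀ j, Fintype (Q j)]
  {M : ∀ i, MDP (S i) Act AP} {T : ∀ j, DFA (Set AP) (Q j)}

/-- A set of states that contains all states visited by the scheduler `μ` of the centralised MDP
before the last task is ended: when task `j` is considered, exactly `j` agents are assigned before
the assignment of task `j`, and `j + 1` agents afterwards; the state of a running agent is visited
by the induced scheduler of the agent-task MDP. -/
inductive Visited (μ : (ctMDP M T).Scheduler) (β : ∀ i j, (agentTask (M i) (T j)).Scheduler) :
    CtState S Q → Prop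
  | unassigned (i j : Fin n) (U : Finset (Fin n)) (hi : i ∉ U) (hU : #U = j)
      (hd : ¬ ((j : ℕ) + 1 = n ∧ (T j).Ended (T j).start)) :
      Visited μ β ⟨(i, j), (M i).init, (T j).start, U⟩
  | running (i j : Fin n) (s : S i) (q : Q j) (U : Finset (Fin n)) (hi : i ∈ U)
      (hU : #U = j + 1) (hq : ¬ (T j).Ended q)
      (hocc : 0 < (agentScheduler μ i j (β i j) U).occ TaskDone (s, q)) :
      Visited μ β ⟨(i, j), s, q, U⟩
  | ended (i j : Fin n) (s : S i) (q : Q j) (U : Finset (Fin n)) (hi : i ∈ U)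
      (hU : #U = j + 1) (hq : (T j).Ended q) (hj : (j : ℕ) + 1 < n) :
      Visited μ β ⟨(i, j), s, q, U⟩

omit [NeZero n] in
lemma sum_initial (F : Fin n → Fin n → Finset (Fin n) → ℝ) [∀ x : CtState S Q, Decidable
      (x.2.1 = (M x.1.1).init ∧ x.2.2.1 = (T x.1.2).start)] (g : CtState S Q → ℝ) :
    ∑ x : CtState S Q, g x *
        (if x.2.1 = (M x.1.1).init ∧ x.2.2.1 = (T x.1.2).start then F x.1.1 x.1.2 x.2.2.2 else 0)
      = ∑ i, ∑ j, ∑ U, g ⟨(i, j), (M i).init, (T j).start, U⟩ * F i j U := by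
  classical
  rw [Fintype.sum_sigma, Fintype.sum_prod_type]
  refine sum_congr rfl fun i _ => sum_congr rfl fun j _ => ?_
  rw [Fintype.sum_prod_type, sum_eq_single (M i).init, Fintype.sum_prod_type,
    sum_eq_single (T j).start]
  · simp
  · intro q _ hq; simp [hq]
  · simp
  · intro s _ hs; simp [hs]
  · simp

variable (μ : (ctMDP M T).Scheduler) (β : ∀ i j, (agentTask (M i) (T j)).Scheduler)

lemma visited_init (h : ¬ CtDone ((ctMDP M T).L (ctMDP M T).init)) :
    Visited μ β (ctMDP M T).init :=
  .unassigned 0 0 ∅ (by simp) (by simp) fun hc => h (ctDone_iff.2 hc)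

lemma visited_of_killedInit_pos {x : CtState S Q} (hx : 0 < killedInit (ctMDP M T) CtDone x) :
    Visited μ β x := by
  rw [killedInit] at hx
  split_ifs at hx with h
  · obtain ⟨rfl, h⟩ := h
    exact visited_init μ β h
  · exact (lt_irrefl _ hx).elim

variable [Fintype Act]
  (hfin : ∀ i j, ∀ ν : (agentTask (M i) (T j)).Scheduler, ν.FiniteHitting TaskDone)

include hfin in
lemma Visited.step {x y : CtState S Q} (hx : Visited μ β x)
    (hxy : 0 < μ.killedMatrix CtDone x y) : Visited μ β y := by
  classical
  refine μ.mem_of_transMean_nonpos CtDone (R := Visited μ β) ?_ hxy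
  set V : CtState S Q → ℝ := fun y => if Visited μ β y then 0 else 1 with hV
  have hV0 : ∀ y, 0 ≤ V y := fun y => by simp only [hV]; split_ifs <;> simp
  have hkill : ∀ y, (¬ CtDone ((ctMDP M T).L y) → Visited μ β y) →
      (ctMDP M T).killFn CtDone V y = 0 := fun y h => killFn_eq_zero fun hd => if_pos (h hd)
  cases hx with
  | unassigned i j U hi hU hd =>
    rw [transMean_unassigned μ hi, hkill, forwardValue]
    · split_ifs with h
      · rw [hkill]
        · simp
        · exact fun _ => .unassigned _ j U (min'_forward h).2 hU hd
      · simp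
    · intro hnd
      rw [ctDone_iff] at hnd
      by_cases he : (T j).Ended (T j).start
      · refine .ended _ _ _ _ _ (mem_insert_self i U) ?_ he ?_
        · rw [card_insert_of_notMem hi, hU]
        · have := j.2
          exact lt_of_le_of_ne this fun h => hnd ⟨h, he⟩
      · refine .running _ _ _ _ _ (mem_insert_self i U) ?_ he ?_
        · rw [card_insert_of_notMem hi, hU]
        · refine (hfin _ _ _).occupation_pos_of_pos (isSubstochastic_killedMatrix _ _)
            (killedInit_nonneg _) ?_
          rw [killedInit, if_pos ⟨rfl, fun hc => he (taskDone_agentTask_iff.1 hc)⟩]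
          exact one_pos
  | running i j s q U hi hU hq hocc =>
    rw [transMean_active μ (β i j) hi hq]
    set ν := agentScheduler μ i j (β i j) U
    set F : S i × Q j → ℝ := fun z => if 0 < ν.occ TaskDone z then 0 else 1 with hF
    have hle : ∀ z : S i × Q j, (ctMDP M T).killFn CtDone V ⟨(i, j), z.1, z.2, U⟩
        ≤ (agentTask (M i) (T j)).killFn TaskDone F z := by
      intro z
      by_cases hz : (T j).Ended z.2
      · rw [killFn_of (taskDone_agentTask_iff.2 hz), hkill]
        intro hnd
        rw [ctDone_iff] at hnd
        exact .ended _ _ _ _ _ hi hU hz (lt_of_le_of_ne j.2 fun h => hnd ⟨h, hz⟩)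
      · rw [killFn_of_not fun hc => hz (taskDone_agentTask_iff.1 hc)]
        by_cases hzo : 0 < ν.occ TaskDone z
        · rw [hkill]
          · simp [hF, hzo]
          · exact fun _ => .running _ _ _ _ _ hi hU hz hzo
        · simp only [hF, hzo, if_false]
          refine (killFn_le (hV0 _)).trans ?_
          simp only [hV]; split_ifs <;> simp
    refine (transMean_mono ν (s, q) hle).trans ?_
    rw [← mulVec_killedMatrix]
    refine (sum_eq_zero fun z _ => ?_).le
    by_cases hz : 0 < ν.killedMatrix TaskDone (s, q) z
    · have := (hfin _ _ ν).occupation_pos_step (isSubstochastic_killedMatrix _ _)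
        (killedInit_nonneg _) hocc hz
      simp [hF, this]
    · have : ν.killedMatrix TaskDone (s, q) z = 0 :=
        le_antisymm (not_lt.1 hz) ((isSubstochastic_killedMatrix _ _).nonneg _ _)
      change ν.killedMatrix TaskDone (s, q) z * F z = 0
      rw [this, zero_mul]
  | ended i j s q U hi hU hq hj =>
    have h := nonempty_unassigned (U := U) (by omega)
    rw [transMean_ended μ hi hq ⟨h, hj⟩, hkill]
    intro hnd
    rw [ctDone_iff] at hnd
    exact .unassigned _ _ _ (min'_unassigned_notMem h) hU hnd

include hfin in
/-- Every scheduler of the centralised MDP ends the last task within finite expected time.  The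
Lyapunov function adds the expected duration of the current task to a bound on the duration of the
remaining assignment phases and tasks. -/
theorem ct_finiteHitting : μ.FiniteHitting CtDone := by
  classical
  let β : ∀ i j, (agentTask (M i) (T j)).Scheduler := fun i j => defaultScheduler _
  let pot : ∀ i j, Finset (Fin n) → S i × Q j → ℝ := fun i j U =>
    (agentTask (M i) (T j)).killFn TaskDone
      (potential ((agentScheduler μ i j (β i j) U).killedMatrix TaskDone) 1)
  have hpot : ∀ i j U z, 0 ≤ pot i j U z := fun i j U z => by
    simp only [pot, killFn]
    split_ifs
    exacts [le_rfl, FiniteLifetime.potential_one_nonneg (isSubstochastic_killedMatrix _ _) z]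
  let D : ℝ := ∑ i, ∑ j, ∑ U, pot i j U ((M i).init, (T j).start)
  have hD : ∀ i j U, pot i j U ((M i).init, (T j).start) ≤ D := by
    intro i j U
    refine le_trans ?_ (single_le_sum (f := fun i => ∑ j, ∑ U, pot i j U ((M i).init, (T j).start))
      (fun i _ => sum_nonneg fun j _ => sum_nonneg fun U _ => hpot i j U _) (mem_univ i))
    refine le_trans ?_ (single_le_sum (f := fun j => ∑ U, pot i j U ((M i).init, (T j).start))
      (fun j _ => sum_nonneg fun U _ => hpot i j U _) (mem_univ j))
    exact single_le_sum (f := fun U => pot i j U ((M i).init, (T j).start))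
      (fun U _ => hpot i j U _) (mem_univ U)
  have hD0 : 0 ≤ D := (hpot 0 0 ∅ _).trans (hD 0 0 ∅)
  -- `C` bounds the duration of one round: at most `n` forwarding steps, one assignment, the task
  -- itself (at most `D`), and the step to the next task.
  let C : ℝ := D + n + 2
  have hC0 : 0 ≤ C := by positivity
  let W : CtState S Q → ℝ := fun x => ((n : ℝ) - 1 - (x.1.2 : ℕ)) * C +
    if x.1.1 ∈ x.2.2.2 then 1 + pot x.1.1 x.1.2 x.2.2.2 (x.2.1, x.2.2.1)
    else D + 2 + ((n : ℝ) - (x.1.1 : ℕ))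
  have hn : ∀ j : Fin n, ((j : ℕ) : ℝ) + 1 ≤ n := fun j => by exact_mod_cast j.2
  have hW0 : ∀ x, 0 ≤ W x := by
    intro x
    have h1 := hn x.1.2
    have h2 := hn x.1.1
    refine add_nonneg (mul_nonneg (by linarith) hC0) ?_
    split_ifs
    · linarith [hpot x.1.1 x.1.2 x.2.2.2 (x.2.1, x.2.2.1)]
    · linarith
  refine finiteLifetime_of_lyapunov (isSubstochastic_killedMatrix _ _) (killedInit_nonneg _)
    (R := Visited μ β) (fun x hx => visited_of_killedInit_pos μ β hx)
    (fun x y hx hxy => hx.step μ β hfin hxy) W hW0 fun x hx => ?_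
  rw [mulVec_killedMatrix]
  have hle : μ.transMean x ((ctMDP M T).killFn CtDone W) ≤ μ.transMean x W :=
    transMean_mono μ x fun y => killFn_le (hW0 y)
  cases hx with
  | unassigned i j U hi hU hd =>
    rw [transMean_unassigned μ hi W] at hle
    have h1 : W ⟨(i, j), (M i).init, (T j).start, insert i U⟩
        ≤ W ⟨(i, j), (M i).init, (T j).start, U⟩ - 1 := by
      simp only [W, mem_insert_self, if_true, hi, if_false]
      linarith [hD i j (insert i U), hn i]
    have h2 : (1 - assignProb μ i j U) * forwardValue M T i j U W
        ≤ (1 - assignProb μ i j U) * (W ⟨(i, j), (M i).init, (T j).start, U⟩ - 1) := by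
      rw [forwardValue]
      split_ifs with h
      · have hp1 : assignProb μ i j U ≤ 1 := assignProb_le_one μ
        refine mul_le_mul_of_nonneg_left ?_ (by linarith)
        obtain ⟨h3, h4⟩ := min'_forward h
        simp only [W, hi, h4, if_false]
        have : ((i : ℕ) : ℝ) + 1 ≤ (min' _ h : Fin n) := by exact_mod_cast h3
        linarith
      · rw [assignProb_eq_one μ hi h]; simp
    have h3 := mul_le_mul_of_nonneg_left h1 (assignProb_nonneg μ (i := i) (j := j) (U := U))
    linarith
  | running i j s q U hi hU hq hocc =>
    rw [transMean_active μ (β i j) hi hq (V := W)] at hle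
    have e : (fun z : S i × Q j => W ⟨(i, j), z.1, z.2, U⟩)
        = fun z => (((n : ℝ) - 1 - (j : ℕ)) * C + 1) + pot i j U z := by
      funext z
      simp only [W, hi, if_true]
      ring
    have e' : (agentScheduler μ i j (β i j) U).transMean (s, q) (pot i j U) = _ :=
      (mulVec_killedMatrix _ _ _ _).symm
    rw [e, transMean_add, transMean_const, e'] at hle
    have h1 := (hfin i j (agentScheduler μ i j (β i j) U)).potential_eq
      (isSubstochastic_killedMatrix _ _) (killedInit_nonneg _) 1 hocc
    have h2 : pot i j U (s, q)
        = potential ((agentScheduler μ i j (β i j) U).killedMatrix TaskDone) 1 (s, q) :=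
      killFn_of_not fun hc => hq (taskDone_agentTask_iff.1 hc)
    have h3 : W ⟨(i, j), s, q, U⟩ = ((n : ℝ) - 1 - (j : ℕ)) * C + (1 + pot i j U (s, q)) := by
      simp only [W, hi, if_true]
    rw [h3, h2, h1, Pi.one_apply]
    linarith
  | ended i j s q U hi hU hq hj =>
    have h := nonempty_unassigned (U := U) (by omega)
    rw [transMean_ended μ hi hq ⟨h, hj⟩ W] at hle
    refine (add_le_add_right hle 1).trans ?_
    simp only [W, hi, if_true, min'_unassigned_notMem h, if_false]
    have h1 := hpot i j U (s, q)
    have h2 : (0 : ℝ) ≤ ((min' _ h : Fin n) : ℕ) := Nat.cast_nonneg _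
    push_cast
    simp only [C]
    linarith

section Verification

variable (V f : CtState S Q → ℝ)

include hfin in
/-- If `V` satisfies the Bellman equation with running reward `f` on the visited states, then the
total reward is the value of `V` at the initial state. -/
lemma sum_occ_mul_eq
    (h : ∀ x, Visited μ β x → V x = f x + μ.transMean x ((ctMDP M T).killFn CtDone V)) :
    ∑ x, μ.occ CtDone x * f x = (ctMDP M T).killFn CtDone V (ctMDP M T).init := by
  have hh := ct_finiteHitting μ hfin
  rw [← sum_killedInit_mul, ← hh.sum_occupation_mul_sub (isSubstochastic_killedMatrix _ _)
    (killedInit_nonneg _)]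
  refine sum_congr rfl fun x _ => ?_
  rcases (occupation_nonneg (μ.isSubstochastic_killedMatrix CtDone)
    (killedInit_nonneg (M := ctMDP M T) CtDone) x).eq_or_lt with h0 | h0
  · simp [← h0]
  · rw [mulVec_killedMatrix, h x (mem_of_occupation_pos (isSubstochastic_killedMatrix _ _)
      (killedInit_nonneg _) (fun x hx => visited_of_killedInit_pos μ β hx)
      (fun x y hx hxy => hx.step μ β hfin hxy) h0)]
    ring

include hfin in
/-- If `V` dominates its Bellman operator with running reward `f` on the visited states, then it
bounds the total reward. -/
lemma sum_occ_mul_le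
    (h : ∀ x, Visited μ β x → f x + μ.transMean x ((ctMDP M T).killFn CtDone V) ≤ V x) :
    ∑ x, μ.occ CtDone x * f x ≤ (ctMDP M T).killFn CtDone V (ctMDP M T).init := by
  have hh := ct_finiteHitting μ hfin
  rw [← sum_killedInit_mul, ← hh.sum_occupation_mul_sub (isSubstochastic_killedMatrix _ _)
    (killedInit_nonneg _)]
  refine sum_le_sum fun x _ => ?_
  rcases (occupation_nonneg (μ.isSubstochastic_killedMatrix CtDone)
    (killedInit_nonneg (M := ctMDP M T) CtDone) x).eq_or_lt with h0 | h0
  · simp [← h0]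
  · refine mul_le_mul_of_nonneg_left ?_ h0.le
    rw [mulVec_killedMatrix]
    linarith [h x (mem_of_occupation_pos (isSubstochastic_killedMatrix _ _)
      (killedInit_nonneg _) (fun x hx => visited_of_killedInit_pos μ β hx)
      (fun x y hx hxy => hx.step μ β hfin hxy) h0)]

end Verification

/-- The probability that task `j` is assigned to agent `i` while `U` is the set of agents assigned
before. -/
def assignMass (i j : Fin n) (U : Finset (Fin n)) : ℝ :=
  μ.occ CtDone ⟨(i, j), (M i).init, (T j).start, U⟩ * assignProb μ i j U

omit [Fintype Act] in
lemma assignMass_nonneg (i j : Fin n) (U : Finset (Fin n)) : 0 ≤ assignMass μ i j U :=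
  mul_nonneg (occupation_nonneg (isSubstochastic_killedMatrix _ _) (killedInit_nonneg _) _)
    (assignProb_nonneg μ)

include hfin in
/-- The reward of a scheduler of the centralised MDP decomposes into the rewards of the induced
schedulers of the agent-task MDPs.  The function that is the remaining expected reward of the
induced scheduler while a task is run, and zero otherwise, satisfies the Bellman equation, except
that it jumps by the reward of the induced scheduler whenever a task is assigned. -/
theorem ct_value_eq (r : ∀ i j, S i × Q j → Act → ℝ) :
    μ.value CtDone (ctReward r) = ∑ i, ∑ j, ∑ U, assignMass μ i j U *
      (agentScheduler μ i j (β i j) (insert i U)).value TaskDone (r i j) := by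
  classical
  let pot : ∀ i j, Finset (Fin n) → S i × Q j → ℝ := fun i j U =>
    (agentTask (M i) (T j)).killFn TaskDone (potential
      ((agentScheduler μ i j (β i j) U).killedMatrix TaskDone)
      ((agentScheduler μ i j (β i j) U).meanReward (r i j)))
  let V : CtState S Q → ℝ := fun x =>
    if x.1.1 ∈ x.2.2.2 then pot x.1.1 x.1.2 x.2.2.2 (x.2.1, x.2.2.1) else 0
  let F : Fin n → Fin n → Finset (Fin n) → ℝ := fun i j U => assignProb μ i j U *
    (agentScheduler μ i j (β i j) (insert i U)).value TaskDone (r i j)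
  let f : CtState S Q → ℝ := fun x =>
    if x.2.1 = (M x.1.1).init ∧ x.2.2.1 = (T x.1.2).start then F x.1.1 x.1.2 x.2.2.2 else 0
  have hf : ∀ x : CtState S Q, x.1.1 ∈ x.2.2.2 → f x = 0 := by
    intro x hx
    simp only [f, F, assignProb_of_mem μ hx, zero_mul, ite_self]
  have hkill : (ctMDP M T).killFn CtDone V = V := by
    funext x
    refine killFn_eq_self fun hx => ?_
    simp only [V, pot]
    rw [killFn_of (taskDone_agentTask_iff.2 (ctDone_iff.1 hx).2), ite_self]
  have key := sum_occ_mul_eq μ β hfin V (fun x => μ.meanReward (ctReward r) x - f x) ?_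
  · have hinit : (ctMDP M T).killFn CtDone V (ctMDP M T).init = 0 := by
      rw [hkill]
      exact if_neg (notMem_empty _)
    rw [hinit] at key
    simp_rw [mul_sub, sum_sub_distrib] at key
    rw [value, sub_eq_zero.1 key]
    simp_rw [f]
    rw [sum_initial F]
    simp_rw [assignMass, F, mul_assoc]
  · intro x hx
    rw [hkill]
    cases hx with
    | unassigned i j U hi hU hd =>
      rw [transMean_unassigned μ hi, meanReward, actMean_unassigned μ hi]
      have h1 : V ⟨(i, j), (M i).init, (T j).start, insert i U⟩
          = (agentScheduler μ i j (β i j) (insert i U)).value TaskDone (r i j) := by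
        simp only [V, mem_insert_self, if_true, pot]
        exact (value_eq_potential _ _ (hfin _ _ _)).symm
      have h2 : forwardValue M T i j U V = 0 := by
        rw [forwardValue]
        split_ifs with h
        · simp only [V, (min'_forward h).2, if_false]
        · rfl
      have h3 : V ⟨(i, j), (M i).init, (T j).start, U⟩ = 0 := by simp only [V, hi, if_false]
      rw [h1, h2, h3]
      simp [stepReward, ctReward, f, F]
    | running i j s q U hi hU hq hocc =>
      rw [transMean_active μ (β i j) hi hq, meanReward, actMean_active μ (β i j) hi hq, hf _ hi]
      set ν := agentScheduler μ i j (β i j) U with hν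
      have e1 : (fun z : S i × Q j => V ⟨(i, j), z.1, z.2, U⟩) = pot i j U := by
        funext z; simp only [V, hi, if_true]
      have e2 : (fun o : Option Act => stepReward (ctReward r) (⟨⟨(i, j), s, q, U⟩,
          o.map Sum.inl⟩ : PathStep (CtState S Q) (Act ⊕ Ctrl))) =
          fun o => stepReward (r i j) ⟨(s, q), o⟩ := by
        funext o; cases o <;> rfl
      have h1 := (hfin i j ν).potential_eq (isSubstochastic_killedMatrix _ _)
        (killedInit_nonneg _) (ν.meanReward (r i j)) hocc
      rw [e1, e2, sub_zero]
      simp only [V, hi, if_true, pot]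
      rw [killFn_of_not fun hc => hq (taskDone_agentTask_iff.1 hc), ← hν, h1, mulVec_killedMatrix]
      rfl
    | ended i j s q U hi hU hq hj =>
      have h := nonempty_unassigned (U := U) (by omega)
      rw [transMean_ended μ hi hq ⟨h, hj⟩, meanReward, actMean_ended μ hi hq ⟨h, hj⟩, hf _ hi]
      simp only [V, hi, if_true, min'_unassigned_notMem h, if_false, pot]
      rw [killFn_of (taskDone_agentTask_iff.2 hq)]
      simp [stepReward, ctReward]

include hfin in
/-- Every task is assigned exactly once, unless it is the last one and it is ended from the
beginning.  The test function is the number (zero or one) of assignments of task `k` that are still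
to come. -/
lemma sum_assignMass_task (k : Fin n) (hk : ¬ ((k : ℕ) + 1 = n ∧ (T k).Ended (T k).start)) :
    ∑ i, ∑ U, assignMass μ i k U = 1 := by
  classical
  let β : ∀ i j, (agentTask (M i) (T j)).Scheduler := fun i j => defaultScheduler _
  let V : CtState S Q → ℝ := fun x =>
    if x.1.1 ∈ x.2.2.2 then (if x.1.2 < k then 1 else 0) else (if x.1.2 ≤ k then 1 else 0)
  let F : Fin n → Fin n → Finset (Fin n) → ℝ := fun i j U =>
    if j = k then assignProb μ i j U else 0
  let f : CtState S Q → ℝ := fun x =>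
    if x.2.1 = (M x.1.1).init ∧ x.2.2.1 = (T x.1.2).start then F x.1.1 x.1.2 x.2.2.2 else 0
  have hf : ∀ x : CtState S Q, x.1.1 ∈ x.2.2.2 → f x = 0 := by
    intro x hx
    simp only [f, F, assignProb_of_mem μ hx, ite_self]
  have hkill : ∀ i j (s : S i) (q : Q j) U,
      i ∈ U ∨ q = (T j).start →
      (ctMDP M T).killFn CtDone V ⟨(i, j), s, q, U⟩ = V ⟨(i, j), s, q, U⟩ := by
    intro i j s q U hor
    refine killFn_eq_self fun hd => ?_
    obtain ⟨h1, h2⟩ := ctDone_iff.1 hd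
    simp only at h1 h2
    by_cases hi : i ∈ U
    · simp only [V, hi, if_true]
      rw [if_neg]
      intro hlt
      have := Fin.lt_def.1 hlt
      have := k.2
      omega
    · simp only [V, hi, if_false]
      rw [if_neg]
      intro hle
      have h3 := Fin.le_def.1 hle
      have h4 := k.2
      have h5 : j = k := Fin.ext (by omega)
      subst h5
      rcases hor with h | h
      · exact hi h
      · exact hk ⟨h1, h ▸ h2⟩
  have key := sum_occ_mul_eq μ β hfin V f ?_
  · have hinit : (ctMDP M T).killFn CtDone V (ctMDP M T).init = 1 := by
      change (ctMDP M T).killFn CtDone V ⟨(0, 0), (M 0).init, (T 0).start, ∅⟩ = 1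
      rw [hkill _ _ _ _ _ (Or.inr rfl)]
      simp [V]
    rw [hinit] at key
    simp_rw [f] at key
    rw [sum_initial F] at key
    rw [← key]
    refine sum_congr rfl fun i _ => ?_
    rw [sum_eq_single k]
    · simp [F, assignMass]
    · intro j _ hj; simp [F, hj]
    · simp
  · intro x hx
    cases hx with
    | unassigned i j U hi hU hd =>
      rw [transMean_unassigned μ hi, hkill _ _ _ _ _ (Or.inr rfl)]
      have h2 : (1 - assignProb μ i j U) * forwardValue M T i j U ((ctMDP M T).killFn CtDone V)
          = (1 - assignProb μ i j U) * if j ≤ k then 1 else 0 := by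
        rw [forwardValue]
        split_ifs with h h'
        · rw [hkill _ _ _ _ _ (Or.inr rfl)]
          simp only [V, (min'_forward h).2, if_false, h', if_true]
        · rw [hkill _ _ _ _ _ (Or.inr rfl)]
          simp only [V, (min'_forward h).2, if_false, h']
        · rw [assignProb_eq_one μ hi h]; simp
        · rfl
      rw [h2]
      simp only [V, hi, if_false, mem_insert_self, if_true, f, F, and_self]
      rcases lt_trichotomy j k with h | h | h
      · simp [h, h.le, h.ne]
      · simp [h]
      · simp [h.not_ge, h.not_gt, h.ne']
    | running i j s q U hi hU hq hocc =>
      rw [transMean_active μ (β i j) hi hq, hf _ hi]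
      simp_rw [hkill i j _ _ U (Or.inl hi)]
      simp only [V, hi, if_true, zero_add]
      exact (transMean_const _ _ _).symm
    | ended i j s q U hi hU hq hj =>
      have h := nonempty_unassigned (U := U) (by omega)
      rw [transMean_ended μ hi hq ⟨h, hj⟩, hf _ hi, hkill _ _ _ _ _ (Or.inr rfl)]
      simp only [V, hi, if_true, min'_unassigned_notMem h, if_false, zero_add]
      congr 1

include hfin in
/-- Every agent is assigned at most one task: the indicator function of the set of states
in which agent `k` is still available decreases by one when this happens. -/
lemma sum_assignMass_agent_le (k : Fin n) : ∑ j, ∑ U, assignMass μ k j U ≤ 1 := by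
  classical
  let β : ∀ i j, (agentTask (M i) (T j)).Scheduler := fun i j => defaultScheduler _
  let V : CtState S Q → ℝ := fun x => if k ∈ x.2.2.2 then 0 else 1
  let F : Fin n → Fin n → Finset (Fin n) → ℝ := fun i j U =>
    if i = k then assignProb μ i j U else 0
  let f : CtState S Q → ℝ := fun x =>
    if x.2.1 = (M x.1.1).init ∧ x.2.2.1 = (T x.1.2).start then F x.1.1 x.1.2 x.2.2.2 else 0
  have hV0 : ∀ x, 0 ≤ V x := fun x => by simp only [V]; split_ifs <;> simp
  have hf : ∀ x : CtState S Q, x.1.1 ∈ x.2.2.2 → f x = 0 := by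
    intro x hx
    simp only [f, F, assignProb_of_mem μ hx, ite_self]
  have key := sum_occ_mul_le μ β hfin V f ?_
  · have hinit : (ctMDP M T).killFn CtDone V (ctMDP M T).init ≤ 1 :=
      (killFn_le (hV0 _)).trans (by simp only [V]; split_ifs <;> simp)
    refine le_trans (le_of_eq (Eq.symm ?_)) (key.trans hinit)
    simp_rw [f]
    rw [sum_initial F, sum_eq_single k]
    · simp [F, assignMass]
    · intro i _ hi; simp [F, hi]
    · simp
  · intro x hx
    have hle : μ.transMean x ((ctMDP M T).killFn CtDone V) ≤ μ.transMean x V :=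
      transMean_mono μ x fun y => killFn_le (hV0 y)
    refine (add_le_add_right hle (f x)).trans (le_of_eq ?_)
    cases hx with
    | unassigned i j U hi hU hd =>
      rw [transMean_unassigned μ hi]
      have h2 : (1 - assignProb μ i j U) * forwardValue M T i j U V
          = (1 - assignProb μ i j U) * if k ∈ U then 0 else 1 := by
        rw [forwardValue]
        split_ifs with h h'
        · simp only [V, h', if_true]
        · simp only [V, h', if_false]
        · rfl
        · rw [assignProb_eq_one μ hi h]; simp
      rw [h2]
      simp only [V, f, F, and_self, if_true]
      by_cases hik : i = k
      · subst hik; simp [hi]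
      · by_cases hkU : k ∈ U <;> simp [hik, hkU, Ne.symm hik]
    | running i j s q U hi hU hq hocc =>
      rw [transMean_active μ (β i j) hi hq, hf _ hi]
      rw [zero_add]
      exact transMean_const (agentScheduler μ i j (β i j) U) (s, q) (V ⟨(i, j), s, q, U⟩)
    | ended i j s q U hi hU hq hj =>
      have h := nonempty_unassigned (U := U) (by omega)
      rw [transMean_ended μ hi hq ⟨h, hj⟩, hf _ hi]
      simp only [V, zero_add]

include hfin in
/-- The assignment probabilities agree with a doubly stochastic matrix, except possibly in the
column of the last task if that task is ended from the beginning. -/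
theorem exists_doublyStochastic_assignment :
    ∃ x ∈ doublyStochastic ℝ (Fin n), ∀ i j, x i j = ∑ U, assignMass μ i j U ∨
      ((j : ℕ) + 1 = n ∧ (T j).Ended (T j).start) := by
  let y : Fin n → Fin n → ℝ := fun i j => ∑ U, assignMass μ i j U
  have hy0 : ∀ i j, 0 ≤ y i j := fun i j => sum_nonneg fun U _ => assignMass_nonneg μ i j U
  have hrow : ∀ i, ∑ j, y i j ≤ 1 := sum_assignMass_agent_le μ hfin
  have hcol : ∀ j : Fin n, ¬ ((j : ℕ) + 1 = n ∧ (T j).Ended (T j).start) → ∑ i, y i j = 1 :=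
    sum_assignMass_task μ hfin
  have hpos : 0 < n := Nat.pos_of_ne_zero (NeZero.ne n)
  let l : Fin n := ⟨n - 1, by omega⟩
  have hl : ∀ j : Fin n, (j : ℕ) + 1 = n ↔ j = l := fun j => by
    rw [Fin.ext_iff]; simp only [l]; omega
  have hcol' : ∀ j, j ≠ l → ∑ i, y i j = 1 := fun j hj => hcol j fun h => hj ((hl j).1 h.1)
  -- The last column takes up what the rows lack.
  let x : Fin n → Fin n → ℝ := fun i j => y i j + if j = l then 1 - ∑ j, y i j else 0
  refine ⟨Matrix.of x, mem_doublyStochastic_iff_sum.2 ⟨fun i j => ?_, fun i => ?_, fun j => ?_⟩,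
    fun i j => ?_⟩
  · refine add_nonneg (hy0 i j) ?_
    split_ifs
    · linarith [hrow i]
    · exact le_rfl
  · simp only [Matrix.of_apply, x, sum_add_distrib, sum_ite_eq', mem_univ, if_true]
    ring
  · by_cases hj : j = l
    · have h1 : ∑ i, ∑ j, y i j = ∑ i, y i l + ((n : ℝ) - 1) := by
        rw [sum_comm, ← add_sum_erase _ _ (mem_univ l),
          sum_congr rfl fun j hj => hcol' j (ne_of_mem_erase hj)]
        simp [card_erase_of_mem, Nat.cast_pred hpos]
      simp only [Matrix.of_apply, x, hj, if_true, sum_add_distrib, sum_sub_distrib, h1]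
      simp only [sum_const, card_univ, Fintype.card_fin, nsmul_eq_mul, mul_one]
      ring
    · simp only [Matrix.of_apply, x, hj, if_false, add_zero]
      exact hcol' j hj
  · by_cases hd : (j : ℕ) + 1 = n ∧ (T j).Ended (T j).start
    · exact Or.inr hd
    · left
      by_cases hj : j = l
      · subst hj
        -- All columns sum to one, hence so do all rows, whose sums are at most one.
        have hall : ∀ j, ∑ i, y i j = 1 := fun j' => by
          by_cases h : j' = l
          · rw [h]; exact hcol l hd
          · exact hcol' j' h
        have hsum : ∑ i, ∑ j, y i j = ∑ _i : Fin n, (1 : ℝ) := by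
          rw [sum_comm]; exact sum_congr rfl fun j _ => hall j
        have := (sum_eq_sum_iff_of_le fun i _ => hrow i).1 hsum i (mem_univ i)
        simp [x, y, this]
      · simp [x, y, hj]

end CentralisedScheduler

end

noncomputable section

open Finset MDP MDP.Scheduler

section Equivalence

variable {n : ℕ} [NeZero n] {S Q : Fin n → Type*} {Act AP : Type*}
  [∀ i, Fintype (S i)] [∀ j, Fintype (Q j)]
  {M : ∀ i, MDP (S i) Act AP} {T : ∀ j, DFA (Set AP) (Q j)}

/-! ### From the centralised MDP to a random assignment -/

omit [NeZero n] in
lemma value_eq_zero_of_ended [Fintype Act] {i j : Fin n} {ν : (agentTask (M i) (T j)).Scheduler}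
    (hν : ν.FiniteHitting TaskDone) (h : (T j).Ended (T j).start) (r : S i × Q j → Act → ℝ) :
    ν.value TaskDone r = 0 := by
  rw [value_eq_potential ν r hν]
  exact killFn_of (taskDone_agentTask_iff.2 h)

/-- The rewards of a scheduler of the centralised MDP are those of a random assignment. -/
theorem exists_assignment_of_ctScheduler [Fintype Act]
    (hfin : ∀ i j, ∀ ν : (agentTask (M i) (T j)).Scheduler, ν.FiniteHitting TaskDone)
    (μ : (ctMDP M T).Scheduler) :
    ∃ x ∈ doublyStochastic ℝ (Fin n), ∃ ν : ∀ i j, (agentTask (M i) (T j)).Scheduler,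
      ∀ r : ∀ i j, S i × Q j → Act → ℝ,
        μ.value CtDone (ctReward r) = ∑ i, ∑ j, x i j * (ν i j).value TaskDone (r i j) := by
  obtain ⟨x, hx, hxy⟩ := exists_doublyStochastic_assignment μ hfin
  have hmix := fun i j => exists_value_eq_sum (hfin i j)
    (fun U => agentScheduler μ i j (defaultScheduler _) (insert i U)) (assignMass μ i j)
    (assignMass_nonneg μ i j)
  choose ν hν using hmix
  refine ⟨x, hx, ν, fun r => ?_⟩
  rw [ct_value_eq μ (fun i j => defaultScheduler _) hfin r]
  refine sum_congr rfl fun i _ => sum_congr rfl fun j _ => ?_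
  rw [← hν]
  rcases hxy i j with h | h
  · rw [h]
  · rw [value_eq_zero_of_ended (hfin i j (ν i j)) h.2, mul_zero, mul_zero]

/-! ### From a random assignment to the centralised MDP -/

open Classical in
/-- The scheduler of the centralised MDP that assigns task `σ i` to agent `i`, and lets the agents
follow given schedulers.  (Should the current agent be the last one available, the task is assigned
to it in any case; this does not happen on the paths of this scheduler unless it is intended.) -/
def permScheduler (ν : ∀ i j, (agentTask (M i) (T j)).Scheduler) (σ : Equiv.Perm (Fin n)) :
    (ctMDP M T).Scheduler where
  choice := fun ⟨(i, j), s, q, U⟩ =>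
    if i ∈ U ∧ ¬ (T j).Ended q then ((ν i j).choice (s, q)).map (Option.map Sum.inl)
    else if i ∉ U ∧ s = (M i).init ∧ q = (T j).start then
      if σ i ≠ j ∧ (univ.filter fun k : Fin n => i < k ∧ k ∉ U).Nonempty then
        PMF.pure (some (Sum.inr Ctrl.forward))
      else PMF.pure (some (Sum.inr Ctrl.assign))
    else (ctMDP M T).defaultScheduler.choice ⟨(i, j), s, q, U⟩
  enabled_of_mem := by
    rintro ⟨⟨i, j⟩, s, q, U⟩ a ha
    dsimp only at ha
    split_ifs at ha with h1 h2 h3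
    · obtain ⟨o, ho, hoa⟩ := (PMF.mem_support_map_iff _ _ _).1 ha
      obtain ⟨b, rfl, rfl⟩ := Option.map_eq_some_iff.1 hoa
      exact ct_enabled_inl.2 ⟨⟨h1.1, fun hc => h1.2 hc.1⟩, (ν i j).enabled_of_mem _ _ ho⟩
    · obtain ⟨hi, rfl, rfl⟩ := h2
      simp only [PMF.support_pure, Set.mem_singleton_iff, Option.some.injEq] at ha
      subst ha
      exact ct_enabled_inr.2 (by simp [ctrlNext, hi, h3.2])
    · obtain ⟨hi, rfl, rfl⟩ := h2
      simp only [PMF.support_pure, Set.mem_singleton_iff, Option.some.injEq] at ha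
      subst ha
      exact ct_enabled_inr.2 (by simp [ctrlNext, hi])
    · exact (ctMDP M T).defaultScheduler.enabled_of_mem _ _ ha
  blocked_of_mem := by
    rintro ⟨⟨i, j⟩, s, q, U⟩ ha
    dsimp only at ha
    split_ifs at ha with h1 h2 h3
    · obtain ⟨o, ho, hoa⟩ := (PMF.mem_support_map_iff _ _ _).1 ha
      rw [Option.map_eq_none_iff] at hoa
      subst hoa
      have h4 := (ν i j).blocked_of_mem _ ho
      refine Set.eq_empty_of_forall_notMem fun a ha => ?_
      obtain a | b := a
      · have h5 := (ct_enabled_inl.1 ha).2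
        rw [h4] at h5
        exact h5
      · obtain ⟨y, hy⟩ := ct_enabled_inr.1 ha
        cases b <;> simp [ctrlNext, h1.1, h1.2] at hy
    · simp at ha
    · simp at ha
    · exact (ctMDP M T).defaultScheduler.blocked_of_mem _ ha

variable (ν : ∀ i j, (agentTask (M i) (T j)).Scheduler) (σ : Equiv.Perm (Fin n))

lemma agentScheduler_permScheduler (i j : Fin n) (U : Finset (Fin n)) :
    agentScheduler (permScheduler ν σ) i j (ν i j) U = ν i j := by
  have h : (agentScheduler (permScheduler ν σ) i j (ν i j) U).choice = (ν i j).choice := by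
    funext z
    simp only [agentScheduler]
    split_ifs with h
    · have h1 : (permScheduler ν σ).choice ⟨(i, j), z.1, z.2, U⟩
          = ((ν i j).choice (z.1, z.2)).map (Option.map Sum.inl) := if_pos h
      rw [h1, PMF.map_comp]
      have h2 : agentPart ∘ Option.map (Sum.inl (β := Ctrl)) = (id : Option Act → Option Act) := by
        funext o; cases o <;> rfl
      rw [h2, PMF.map_id]
    · rfl
  generalize agentScheduler (permScheduler ν σ) i j (ν i j) U = μ at h
  generalize ν i j = μ' at h
  cases μ; cases μ'
  simpa using h

lemma assignProb_permScheduler_of_eq {i j : Fin n} {U : Finset (Fin n)} (hi : i ∉ U)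
    (h : σ i = j) : assignProb (permScheduler ν σ) i j U = 1 := by
  have h1 : (permScheduler ν σ).choice ⟨(i, j), (M i).init, (T j).start, U⟩
      = PMF.pure (some (Sum.inr Ctrl.assign)) := by
    simp [permScheduler, hi, h]
  simp [assignProb, h1]

lemma assignProb_permScheduler_of_ne {i j : Fin n} {U : Finset (Fin n)} (h : σ i ≠ j)
    (hU : (univ.filter fun k : Fin n => i < k ∧ k ∉ U).Nonempty) :
    assignProb (permScheduler ν σ) i j U = 0 := by
  by_cases hi : i ∈ U
  · exact assignProb_of_mem _ hi
  have h1 : (permScheduler ν σ).choice ⟨(i, j), (M i).init, (T j).start, U⟩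
      = PMF.pure (some (Sum.inr Ctrl.forward)) := by
    simp [permScheduler, hi, h, hU]
  simp [assignProb, h1]

/-- The states in which the assignments made so far follow the permutation `σ`. -/
def FollowsPerm (σ : Equiv.Perm (Fin n)) (x : CtState S Q) : Prop :=
  (x.1.1 ∈ x.2.2.2 ∧ ∀ k, k ∈ x.2.2.2 ↔ σ k ≤ x.1.2) ∨
    (x.1.1 ∉ x.2.2.2 ∧ (∀ k, k ∈ x.2.2.2 ↔ σ k < x.1.2) ∧ x.1.1 ≤ σ.symm x.1.2)

omit [NeZero n] [∀ i, Fintype (S i)] [∀ j, Fintype (Q j)] in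
lemma FollowsPerm.forward_nonempty {i j : Fin n} {s : S i} {q : Q j} {U : Finset (Fin n)}
    (hx : FollowsPerm (S := S) (Q := Q) σ ⟨(i, j), s, q, U⟩) (hi : i ∉ U) (hij : σ i ≠ j) :
    σ.symm j ∈ univ.filter fun k : Fin n => i < k ∧ k ∉ U := by
  obtain ⟨h, -⟩ | ⟨-, h1, h2⟩ := hx
  · exact (hi h).elim
  · refine mem_filter.2 ⟨mem_univ _, lt_of_le_of_ne h2 fun h => hij (by simp [h]), fun hc => ?_⟩
    have := (h1 _).1 hc
    simp at this

variable [Fintype Act]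
  (hfin : ∀ i j, ∀ ν : (agentTask (M i) (T j)).Scheduler, ν.FiniteHitting TaskDone)

lemma FollowsPerm.step {β : ∀ i j, (agentTask (M i) (T j)).Scheduler} {x y : CtState S Q}
    (hv : Visited (permScheduler ν σ) β x)
    (hx : FollowsPerm σ x) (hxy : 0 < (permScheduler ν σ).killedMatrix CtDone x y) :
    FollowsPerm σ y := by
  classical
  refine (permScheduler ν σ).mem_of_transMean_nonpos CtDone (R := FollowsPerm σ) ?_ hxy
  set V : CtState S Q → ℝ := fun y => if FollowsPerm σ y then 0 else 1 with hV
  have hV0 : ∀ y, 0 ≤ V y := fun y => by simp only [hV]; split_ifs <;> simp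
  have hV1 : ∀ y, FollowsPerm σ y → V y = 0 := fun y hy => if_pos hy
  refine (transMean_mono _ x fun y => killFn_le (hV0 y)).trans (le_of_eq ?_)
  cases hv with
  | unassigned i j U hi hU hd =>
    rw [transMean_unassigned _ hi]
    by_cases hij : σ i = j
    · obtain ⟨h, -⟩ | ⟨-, h1, h2⟩ := hx
      · exact (hi h).elim
      rw [assignProb_permScheduler_of_eq ν σ hi hij, hV1]
      · simp
      · refine Or.inl ⟨mem_insert_self _ _, fun k => ?_⟩
        simp only at h1 ⊢
        rw [mem_insert, h1, le_iff_lt_or_eq, or_comm, ← hij, σ.injective.eq_iff]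
    · have hm := hx.forward_nonempty σ hi hij
      obtain ⟨h, -⟩ | ⟨-, h1, h2⟩ := hx
      · exact (hi h).elim
      have h3 : forwardValue M T i j U V = 0 := by
        rw [forwardValue, dif_pos ⟨_, hm⟩]
        exact hV1 _ (Or.inr ⟨(min'_forward ⟨_, hm⟩).2, h1, min'_le _ _ hm⟩)
      rw [assignProb_permScheduler_of_ne ν σ hij ⟨_, hm⟩, h3, zero_mul, mul_zero, add_zero]
  | running i j s q U hi hU hq hocc =>
    rw [transMean_active _ (β i j) hi hq]
    have : ∀ z : S i × Q j, V ⟨(i, j), z.1, z.2, U⟩ = 0 := fun z => by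
      obtain ⟨-, h1⟩ | ⟨h, -⟩ := hx
      · exact hV1 _ (Or.inl ⟨hi, h1⟩)
      · exact (h hi).elim
    simp_rw [this]
    exact transMean_const _ _ _
  | ended i j s q U hi hU hq hj =>
    have h := nonempty_unassigned (U := U) (by omega)
    rw [transMean_ended _ hi hq ⟨h, hj⟩, hV1]
    obtain ⟨-, h1⟩ | ⟨h, -⟩ := hx
    · refine Or.inr ⟨min'_unassigned_notMem h, fun k => ?_, min'_le _ _ ?_⟩
      · simp only at h1 ⊢
        rw [h1, Fin.le_def, Fin.lt_def, Nat.lt_succ_iff]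
      · refine mem_filter.2 ⟨mem_univ _, fun hc => ?_⟩
        have := (h1 _).1 hc
        rw [Equiv.apply_symm_apply, Fin.le_def] at this
        simp at this
    · exact (h hi).elim

include hfin in
lemma assignMass_permScheduler_of_ne {i j : Fin n} (hij : σ i ≠ j) (U : Finset (Fin n)) :
    assignMass (permScheduler ν σ) i j U = 0 := by
  by_cases hi : i ∈ U
  · rw [assignMass, assignProb_of_mem _ hi, mul_zero]
  set μ := permScheduler ν σ with hμ
  rcases (occupation_nonneg (μ.isSubstochastic_killedMatrix CtDone)
    (killedInit_nonneg (M := ctMDP M T) CtDone)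
    ⟨(i, j), (M i).init, (T j).start, U⟩).eq_or_lt with h0 | h0
  · rw [assignMass, occ, ← h0, zero_mul]
  · have h1 := mem_of_occupation_pos (R := fun x => Visited μ ν x ∧ FollowsPerm σ x)
      (isSubstochastic_killedMatrix _ _) (killedInit_nonneg _)
      (fun x hx => ⟨visited_of_killedInit_pos μ ν hx, ?_⟩)
      (fun x y hx hxy => ⟨hx.1.step μ ν hfin hxy, FollowsPerm.step ν σ hx.1 hx.2 hxy⟩) h0
    · rw [assignMass, hμ, assignProb_permScheduler_of_ne ν σ hij
        ⟨_, h1.2.forward_nonempty σ hi hij⟩, mul_zero]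
    · have hxi : x = (ctMDP M T).init := by
        by_contra hne
        simp [killedInit, hne] at hx
      subst hxi
      exact Or.inr ⟨notMem_empty _, fun k => ⟨fun h => (notMem_empty _ h).elim,
        fun h => (Fin.not_lt_zero _ h).elim⟩, Fin.zero_le _⟩

include hfin in
lemma value_permScheduler (r : ∀ i j, S i × Q j → Act → ℝ) :
    (permScheduler ν σ).value CtDone (ctReward r)
      = ∑ i, ∑ j, σ.permMatrix ℝ i j * (ν i j).value TaskDone (r i j) := by
  rw [ct_value_eq _ ν hfin r]
  refine sum_congr rfl fun i _ => sum_congr rfl fun j _ => ?_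
  simp_rw [agentScheduler_permScheduler, ← sum_mul]
  have hp : σ.permMatrix ℝ i j = if σ i = j then 1 else 0 := by
    simp [Equiv.Perm.permMatrix, PEquiv.toMatrix_apply, Equiv.toPEquiv_apply, eq_comm]
  rw [hp]
  by_cases hd : (j : ℕ) + 1 = n ∧ (T j).Ended (T j).start
  · rw [value_eq_zero_of_ended (hfin i j (ν i j)) hd.2, mul_zero, mul_zero]
  · by_cases hij : σ i = j
    · have h1 := sum_assignMass_task (permScheduler ν σ) hfin j hd
      rw [sum_eq_single i] at h1
      · rw [h1, if_pos hij]
      · intro k _ hk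
        refine sum_eq_zero fun U _ => assignMass_permScheduler_of_ne ν σ hfin (fun h => hk ?_) U
        exact σ.injective (h.trans hij.symm)
      · simp
    · rw [if_neg hij, sum_eq_zero fun U _ => assignMass_permScheduler_of_ne ν σ hfin hij U]

include hfin in
/-- The rewards of a random assignment are those of a scheduler of the centralised MDP: by the
Birkhoff theorem the assignment is a mixture of permutations, each of which the centralised MDP can
follow. -/
theorem exists_ctScheduler_of_assignment {x : Matrix (Fin n) (Fin n) ℝ}
    (hx : x ∈ doublyStochastic ℝ (Fin n)) :
    ∃ μ : (ctMDP M T).Scheduler, ∀ r : ∀ i j, S i × Q j → Act → ℝ,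
      μ.value CtDone (ctReward r) = ∑ i, ∑ j, x i j * (ν i j).value TaskDone (r i j) := by
  obtain ⟨w, hw0, hw1, hwx⟩ := exists_eq_sum_perm_of_mem_doublyStochastic hx
  obtain ⟨μ, hμ⟩ := exists_value_eq_sum (fun μ => ct_finiteHitting μ hfin) (permScheduler ν) w hw0
  refine ⟨μ, fun r => ?_⟩
  have h1 := hμ (ctReward r)
  rw [hw1, one_mul] at h1
  rw [h1]
  simp_rw [value_permScheduler ν _ hfin, ← hwx, Matrix.sum_apply, Matrix.smul_apply, smul_eq_mul,
    sum_mul, mul_sum, ← mul_assoc]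
  rw [sum_comm]
  exact sum_congr rfl fun i _ => sum_comm

/-! ### Rewards of single agents and tasks -/

lemma EReal.coe_sum_real {ι : Type*} (s : Finset ι) (f : ι → ℝ) :
    ((∑ i ∈ s, f i : ℝ) : EReal) = ∑ i ∈ s, (f i : EReal) :=
  map_sum (⟨⟨Real.toEReal, EReal.coe_zero⟩, EReal.coe_add⟩ : ℝ →+ EReal) f s

lemma value_ite {S Act AP : Type*} [Fintype S] [Fintype Act] {M : MDP S Act AP}
    (ν : M.Scheduler) (B : Set AP → Prop) (P : Prop) [Decidable P] (ρ : S → Act → ℝ) :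
    ν.value B (fun z a => if P then ρ z a else 0) = if P then ν.value B ρ else 0 := by
  by_cases h : P
  · simp [h]
  · have : ∀ x : PathStep S Act, stepReward (fun _ _ => (0 : ℝ)) x = 0 := by
      rintro ⟨s, _ | a⟩ <;> rfl
    simp [h, value, meanReward, actMean, this]

end Equivalence

end

theorem theorem2 {n : ℕ} [NeZero n] {S Q : Fin n → Type*} {Act AP : Type*}
    [∀ i, Fintype (S i)] [∀ j, Fintype (Q j)] [Finite Act]
    (M : ∀ i, MDP (S i) Act AP) (T : ∀ j, DFA (Set AP) (Q j))
    (accept_sink : ∀ j, ∀ q ∈ (T j).accept, (T j).suc q = {q})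
    (ρ : ∀ i, S i → Act → ℝ)
    (reward_finite : ∀ i j,
      (agentTask (M i) (T j)).RewardFinite (costReward (ρ i)) TaskDone)
    (p c : Fin n → ℝ) (hp : ∀ j, p j ∈ Set.Icc (0 : ℝ) 1) :
    MorapFeasible M T ρ p c ↔
      ∃ μ : (ctMDP M T).Scheduler,
        (∀ j, (p j : EReal) ≤ (ctMDP M T).reachReward (ctTaskReward T j) CtDone μ) ∧
        (∀ i, (c i : EReal) ≤ (ctMDP M T).reachReward (ctCostReward ρ i) CtDone μ) := by
  classical
  have : Fintype Act := Fintype.ofFinite Act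
  have hfin : ∀ i j, ∀ ν : (agentTask (M i) (T j)).Scheduler, ν.FiniteHitting TaskDone :=
    fun i j ν => (reward_finite i j).finiteHitting ν
  -- For real-valued rewards, both conditions are inequalities between the same sums as soon as the
  -- rewards of the centralised scheduler are those of the random assignment.
  have key : ∀ (x : Matrix (Fin n) (Fin n) ℝ) (ν : ∀ i j, (agentTask (M i) (T j)).Scheduler)
      (μ : (ctMDP M T).Scheduler),
      (∀ r : ∀ i j, S i × Q j → Act → ℝ, μ.value CtDone (ctReward r)
        = ∑ i, ∑ j, x i j * (ν i j).value TaskDone (r i j)) →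
      (∀ j, (ctMDP M T).reachReward (ctTaskReward T j) CtDone μ = ∑ i, (x i j : EReal) *
        (agentTask (M i) (T j)).reachReward (taskReward (T j)) TaskDone (ν i j)) ∧
      (∀ i, (ctMDP M T).reachReward (ctCostReward ρ i) CtDone μ = ∑ j, (x i j : EReal) *
        (agentTask (M i) (T j)).reachReward (costReward (ρ i)) TaskDone (ν i j)) := by
    intro x ν μ h
    have hμ := ct_finiteHitting μ hfin
    refine ⟨fun k => ?_, fun k => ?_⟩
    · rw [μ.reachReward_eq_value _ hμ, ctTaskReward, h]
      simp_rw [MDP.Scheduler.reachReward_eq_value _ _ (hfin _ _ _), value_ite, mul_ite, mul_zero,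
        Finset.sum_ite_eq', Finset.mem_univ, if_true, EReal.coe_sum_real, EReal.coe_mul]
    · rw [μ.reachReward_eq_value _ hμ, ctCostReward, h]
      have e : ∀ i j, x i j * (ν i j).value TaskDone
          (fun z a => if i = k then costReward (ρ i) z a else 0)
            = if i = k then x i j * (ν i j).value TaskDone (costReward (ρ i)) else 0 := by
        intro i j
        rw [value_ite, mul_ite, mul_zero]
      simp_rw [e]
      rw [Finset.sum_comm]
      simp_rw [MDP.Scheduler.reachReward_eq_value _ _ (hfin _ _ _), Finset.sum_ite_eq',
        Finset.mem_univ, if_true, EReal.coe_sum_real, EReal.coe_mul]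
  constructor
  · rintro ⟨x, hx, ν, h1, h2⟩
    obtain ⟨μ, hμ⟩ := exists_ctScheduler_of_assignment ν hfin hx
    obtain ⟨k1, k2⟩ := key x ν μ hμ
    exact ⟨μ, fun j => (k1 j).symm ▸ h1 j, fun i => (k2 i).symm ▸ h2 i⟩
  · rintro ⟨μ, h1, h2⟩
    obtain ⟨x, hx, ν, hν⟩ := exists_assignment_of_ctScheduler hfin μ
    obtain ⟨k1, k2⟩ := key x ν μ hν
    exact ⟨x, hx, ν, fun j => k1 j ▸ h1 j, fun i => k2 i ▸ h2 i⟩
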